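/- For a finite graph $F$ with $v(F)\ge 3$ vertices and $e(F)$ edges let $d_2(F)=\frac{e(F)-1}{v(F)-2}$; put $d_2(F)=1$ if $F$ is a single edge (on two vertices) and $d_2(F)=0$ if $F$ has at most two vertices and no edge. For a finite graph $H$ let $m_2(H)=\max_{H'\subseteq H} d_2(H')$, the maximum being over all subgraphs $H'$ of $H$ (including single vertices and single edges), and let $$m_2^{(r)}(H)=\min_{V(H)=P_1\cup\dots\cup P_r}\ \max_{1\le i\le r} m_2(H[P_i]),$$ the minimum being over all partitions of $V(H)$ into $r$ (possibly empty) parts. In the $(1:1)$ Maker-Breaker $H$-game on a graph $G$, two players, Maker and Breaker, alternately claim one previously unclaimed edge of $G$ until all edges are claimed; Maker wins if the edges claimed by her contain all edges of some (not necessarily induced) copy of $H$ in $G$, and otherwise Breaker wins. "Maker wins" means that Maker has a winning strategy, no matter who makes the first move. **Theorem 1.5.** Let $\gamma>0$ be real, let $r\ge 2$ be an integer, let $\alpha\in\left(\frac{r-2}{r-1},\frac{r-1}{r}\right]$, and let $H$ be a fixed finite graph with $m_2^{(r)}(H)>0$. For every sufficiently large $n$ let $G_\alpha=G_\alpha(n)$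 be a graph on $n$ vertices with minimum degree $\delta(G_\alpha)\ge\alpha n$, and let $p=p(n)\in[0,1]$ satisfy $p\ge n^{-1/m_2^{(r)}(H)+\gamma}$. Let $G_{n,p}$ be the binomial random graph on the vertex set of $G_\alpha$, in which each pair of vertices is an edge independently with probability $p$. Then, with probability tending to $1$ as $n\to\infty$, Maker wins the $(1:1)$ Maker-Breaker $H$-game on $G_\alpha\cup G_{n,p}$. -/

import Mathlib

open Filter Topology
open scoped SimpleGraph

/-- The two players of a Maker-Breaker game. -/
inductive Player where
  | maker : Player
  | breaker : Player

/-- `MakerWinsFrom board winningSets turn M B` says that in the `(1:1)` Maker-Breaker game on the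
hypergraph `(board, winningSets)` Maker has a strategy that wins, against every play of Breaker,
from the position in which Maker has claimed `M`, Breaker has claimed `B` and it is the turn of the
player `turn`.  It is defined by backward induction:
* Maker has won as soon as she has fully claimed a winning set;
* at Maker's turn she needs one free element whose claiming leads to a winning position;
* at Breaker's turn there has to be a free element left (otherwise the game is over without Maker
  having claimed a winning set, and Breaker has won), and each of Breaker's possible moves has to
  lead to a position that is winning for Maker. -/
inductive MakerWinsFrom {X : Type*} (board : Set X) (winningSets : Set (Set X)) :
    Player → Set X → Set X → Prop where
  | claimed (turn : Player) (M B S : Set X) (hS : S ∈ winningSets) (hM : S ⊆ M) :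
      MakerWinsFrom board winningSets turn M B
  | makerMove (M B : Set X) (e : X) (he : e ∈ board \ (M ∪ B))
      (h : MakerWinsFrom board winningSets Player.breaker (insert e M) B) :
      MakerWinsFrom board winningSets Player.maker M B
  | breakerMove (M B : Set X) (hfree : (board \ (M ∪ B)).Nonempty)
      (h : ∀ e ∈ board \ (M ∪ B), MakerWinsFrom board winningSets Player.maker M (insert e B)) :
      MakerWinsFrom board winningSets Player.breaker M B

/-- Maker has a winning strategy in the `(1:1)` Maker-Breaker game on `(board, winningSets)`,
no matter which of the two players starts. -/
def MakerWins {X : Type*} (board : Set X) (winningSets : Set (Set X)) : Prop :=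
  ∀ first : Player, MakerWinsFrom board winningSets first ∅ ∅

namespace SimpleGraph

/-- The edge sets of the (not necessarily induced) copies of `H` in `G`. -/
def copyEdgeSets {V W : Type*} (H : SimpleGraph W) (G : SimpleGraph V) : Set (Set (Sym2 V)) :=
  Set.range fun f : Copy H G => f.toSubgraph.edgeSet

/-- Maker wins the `(1:1)` Maker-Breaker `H`-game played on the edges of `G`. -/
def MakerWinsHGame {V W : Type*} (H : SimpleGraph W) (G : SimpleGraph V) : Prop :=
  MakerWins G.edgeSet (copyEdgeSets H G)

open Classical in
/-- The 2-density `d₂(H') = (e(H') - 1) / (v(H') - 2)` of a graph `H'` (given as a subgraph of `H`)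
on at least three vertices, with the conventions that `d₂` of a single edge is `1` and that `d₂`
of any other graph on at most two vertices, in particular of a single vertex, is `0`. -/
noncomputable def Subgraph.twoDensity {W : Type*} {H : SimpleGraph W} (H' : H.Subgraph) : ℝ :=
  if 3 ≤ H'.verts.ncard then ((H'.edgeSet.ncard : ℝ) - 1) / ((H'.verts.ncard : ℝ) - 2)
  else if H'.edgeSet.Nonempty then 1 else 0

/-- The maximum 2-density `m₂(H)` of a finite graph: the maximum of `d₂(H')` over all subgraphs
`H'` of `H`, single edges and single vertices included. -/
noncomputable def maxTwoDensity {W : Type*} (H : SimpleGraph W) : ℝ :=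
  ⨆ H' : H.Subgraph, H'.twoDensity

/-- The `r`-partite 2-density `m₂⁽ʳ⁾(H)` of a finite graph: the minimum of `maxᵢ m₂(H[Pᵢ])` over
all partitions of the vertex set into `r` (possibly empty) parts `Pᵢ = c⁻¹(i)`. -/
noncomputable def partiteTwoDensity {W : Type*} (r : ℕ) (H : SimpleGraph W) : ℝ :=
  ⨅ c : W → Fin r, ⨆ i : Fin r, (H.induce (c ⁻¹' {i})).maxTwoDensity

end SimpleGraph

/-!
# Maker's win in the `H`-game on a randomly perturbed graph

The proof combines Beck's potential criterion for Maker with first and second moments.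

*Potential.* Give each winning set that Breaker has not touched the weight `2⁻ᵏ`, `k` being the
number of its elements that Maker still needs. If Maker claims an element of maximal degree, then
a round lowers the potential by at most the number of sets through both elements claimed in it.
So Maker wins on a family `(A i)` in which every two elements `x ≠ y` lie in at most `w x + w y`
common sets, provided that `∑ w` and the degrees are small compared with the size of the family
(`makerWins_of_codegree_le`). Deleting the sets that violate such bounds turns this into a condition
on the number of pairs of sets that overlap (`makerWins_of_overlapCost`), and this number is easily
estimated in expectation.

*The family.* Let `m` be the partite 2-density of `H`, let `c` be an optimal `r`-colouring of the
vertices of `H`, and write `p = n ^ (-l)`. The minimum degree of `G` gives a positive density of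
`r`-cliques, hence (Cauchy-Schwarz) a positive density of maps that send all pairs of different
colours to edges of `G`. For a suitable colouring `χ` of the vertices of `G` a positive fraction of
all maps are injective, have this property and respect the colours
(`exists_card_colouredEmbeddings_ge`). Each of these gives a copy of `H` as soon as the random graph
contains the images of the inner edges, those with both ends of the same colour. Because of `χ` no
pair of vertices is an inner edge of one copy and a cross edge of another.

*The weights.* There are at most `n²` cross edges and about `n² p` inner ones, so the total weight
is negligible if a cross edge gets the weight `M n ^ (-g / 2) / n²` and an inner edge
`M n ^ (-g / 2) / (n² p)`, where `M` is the expected number of copies and `g = min γ 1`. Copies that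
overlap in the images of a vertex set `U` of `H` with `e` inner edges inside `U` contribute about
`M² / (n ^ |U| p ^ e)` pairs. What is needed is that `n ^ |U| p ^ e` exceeds `n²` by a factor of
`n ^ g` if the overlap contains two cross edges, and exceeds `n² p` by that factor if it contains an
inner edge and a further edge. Both follow from the definition of `m`, applied to each colour class
separately (`edgeExponent_add_gap_le`). The same estimates bound the variance of the number of
copies, and Markov's inequality, applied once to the sum of the three error terms, shows that Maker
loses with probability `O(n ^ (-g / 2))` (`prob_not_makerWinsHGame_le`).
-/

/-! ### A potential criterion for Maker -/

section Potential

variable {X ι : Type*} [DecidableEq X]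

/-- The potential of a position: every set `A i`, `i ∈ J`, that Breaker has not touched contributes
`2⁻ᵏ`, where `k` is the number of its elements that Maker still has to claim. -/
noncomputable def makerPotential (J : Finset ι) (A : ι → Finset X) (M B : Finset X) : ℝ :=
  ∑ i ∈ J, if Disjoint (A i) B then (1 / 2 : ℝ) ^ (A i \ M).card else 0

/-- The part of the potential that is contributed by the sets containing `x`. -/
noncomputable def potentialDegree (J : Finset ι) (A : ι → Finset X) (M B : Finset X) (x : X) : ℝ :=
  ∑ i ∈ J, if Disjoint (A i) B ∧ x ∈ A i then (1 / 2 : ℝ) ^ (A i \ M).card else 0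

/-- The effect on a single set of one round, in which Maker claims `x` and then Breaker claims `y`:
only a set that contains both can contribute less than its old term, plus that term if it contains
`x`, minus that term if it contains `y`. -/
lemma potential_term_step (S M B : Finset X) {x y : X} (hxM : x ∉ M) :
    ((((if Disjoint S B then (1 / 2 : ℝ) ^ (S \ M).card else 0)
        + if Disjoint S B ∧ x ∈ S then (1 / 2 : ℝ) ^ (S \ M).card else 0)
        - if Disjoint S B ∧ y ∈ S then (1 / 2 : ℝ) ^ (S \ M).card else 0)
        - if x ∈ S ∧ y ∈ S then (1 : ℝ) else 0)
      ≤ if Disjoint S (insert y B) then (1 / 2 : ℝ) ^ (S \ insert x M).card else 0 := by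
  have hle : (1 / 2 : ℝ) ^ (S \ M).card ≤ 1 := pow_le_one₀ (by norm_num) (by norm_num)
  by_cases hB : Disjoint S B
  · by_cases hx : x ∈ S
    · have hcard : (S \ M).card = (S \ insert x M).card + 1 := by
        rw [Finset.sdiff_insert, Finset.card_erase_of_mem (by simp [hx, hxM])]
        have : 0 < (S \ M).card := Finset.card_pos.2 ⟨x, by simp [hx, hxM]⟩
        omega
      by_cases hy : y ∈ S
      · simp only [hB, hx, hy, Finset.disjoint_insert_right]
        simp only [and_true, not_true_eq_false, if_true, if_false]
        linarith
      · simp only [hB, hx, hy, Finset.disjoint_insert_right, hcard, pow_succ]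
        simp only [and_true, not_false_eq_true, if_true, and_false, if_false]
        linarith
    · by_cases hy : y ∈ S
      · simp [hB, hx, hy]
      · simp [hB, hx, hy, Finset.sdiff_insert]
  · have : ¬ Disjoint S (insert y B) := fun h =>
      hB (h.mono_right (Finset.subset_insert y B))
    simp only [hB, this, false_and, if_false]
    split_ifs <;> norm_num

lemma makerPotential_step (J : Finset ι) (A : ι → Finset X) (M B : Finset X) {x y : X}
    (hxM : x ∉ M) :
    makerPotential J A M B + potentialDegree J A M B x - potentialDegree J A M B y
        - ((J.filter fun i => x ∈ A i ∧ y ∈ A i).card : ℝ)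
      ≤ makerPotential J A (insert x M) (insert y B) := by
  have hc : ((J.filter fun i => x ∈ A i ∧ y ∈ A i).card : ℝ)
      = ∑ i ∈ J, if x ∈ A i ∧ y ∈ A i then (1 : ℝ) else 0 := by
    rw [Finset.card_filter]; push_cast; rfl
  rw [hc]
  unfold makerPotential potentialDegree
  rw [← Finset.sum_add_distrib, ← Finset.sum_sub_distrib, ← Finset.sum_sub_distrib]
  exact Finset.sum_le_sum fun i _ => potential_term_step (A i) M B hxM

lemma makerPotential_insert_ge (J : Finset ι) (A : ι → Finset X) (M B : Finset X) (x : X) :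
    makerPotential J A M B ≤ makerPotential J A (insert x M) B := by
  refine Finset.sum_le_sum fun i _ => ?_
  split_ifs
  · exact pow_le_pow_of_le_one (by norm_num) (by norm_num)
      (Finset.card_le_card (Finset.sdiff_subset_sdiff le_rfl (Finset.subset_insert x M)))
  · exact le_rfl

/-- If the board is exhausted and the potential is positive, then Maker has claimed a set. -/
lemma makerWinsFrom_of_exhausted {board : Finset X} {winning : Set (Set X)} {J : Finset ι}
    {A : ι → Finset X} (hA : ∀ i ∈ J, A i ⊆ board) (hwin : ∀ i ∈ J, (A i : Set X) ∈ winning)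
    (turn : Player) {M B : Finset X} (hfree : board \ (M ∪ B) = ∅)
    (hpos : 0 < makerPotential J A M B) :
    MakerWinsFrom (board : Set X) winning turn (M : Set X) (B : Set X) := by
  obtain ⟨i, hi, hne⟩ := Finset.exists_ne_zero_of_sum_ne_zero hpos.ne'
  have hdis : Disjoint (A i) B := by
    by_contra h
    simp [h] at hne
  refine MakerWinsFrom.claimed turn _ _ (A i) (hwin i hi) ?_
  intro x hx
  have hxb := hA i hi hx
  by_contra hxM
  have hxB : x ∉ B := fun h => (Finset.disjoint_left.1 hdis) hx h
  have : x ∈ board \ (M ∪ B) := by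
    simp only [Finset.mem_sdiff, Finset.mem_union]
    exact ⟨hxb, fun h => h.elim (fun h => hxM (by simpa using h)) hxB⟩
  rw [hfree] at this
  simp at this

/-- Maker, being on move, wins from every position whose potential exceeds the total weight of the
free elements: claiming an element of maximal degree, she loses in each round at most the number
of sets through the two elements claimed in that round. -/
lemma makerWinsFrom_of_potential {board : Finset X} {winning : Set (Set X)} {J : Finset ι}
    {A : ι → Finset X} (hA : ∀ i ∈ J, A i ⊆ board) (hwin : ∀ i ∈ J, (A i : Set X) ∈ winning)
    {w : X → ℝ} (hw : ∀ x, 0 ≤ w x)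
    (hcodeg : ∀ x y, x ≠ y → ((J.filter fun i => x ∈ A i ∧ y ∈ A i).card : ℝ) ≤ w x + w y)
    (k : ℕ) : ∀ M B : Finset X, (board \ (M ∪ B)).card = k →
      ∑ x ∈ board \ (M ∪ B), w x < makerPotential J A M B →
      MakerWinsFrom (board : Set X) winning Player.maker (M : Set X) (B : Set X) := by
  induction k using Nat.strong_induction_on with
  | _ k ih =>
    intro M B hk hT
    rcases (board \ (M ∪ B)).eq_empty_or_nonempty with hempty | hne
    · refine makerWinsFrom_of_exhausted hA hwin _ hempty ?_
      simpa [hempty] using hT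
    obtain ⟨x, hx, hmax⟩ := Finset.exists_max_image _ (potentialDegree J A M B) hne
    have hxmem : x ∈ (board : Set X) \ ((M : Set X) ∪ (B : Set X)) := by
      simpa using hx
    refine MakerWinsFrom.makerMove _ _ x hxmem ?_
    rw [← Finset.coe_insert]
    have hxb : x ∈ board := (Finset.mem_sdiff.1 hx).1
    have hxMB : x ∉ M ∪ B := (Finset.mem_sdiff.1 hx).2
    have hxM : x ∉ M := fun h => hxMB (Finset.mem_union_left _ h)
    have hfree_erase : board \ (insert x M ∪ B) = (board \ (M ∪ B)).erase x := by
      rw [Finset.insert_union, Finset.sdiff_insert]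
    rcases (board \ (insert x M ∪ B)).eq_empty_or_nonempty with hempty' | hne'
    · refine makerWinsFrom_of_exhausted hA hwin _ hempty' ?_
      refine lt_of_lt_of_le ?_ (makerPotential_insert_ge J A M B x)
      exact lt_of_le_of_lt (Finset.sum_nonneg fun z _ => hw z) hT
    · refine MakerWinsFrom.breakerMove _ _ ?_ ?_
      · obtain ⟨z, hz⟩ := hne'
        exact ⟨z, by simpa [and_assoc] using hz⟩
      · intro y hy
        have hy' : y ∈ board \ (insert x M ∪ B) := by simpa [and_assoc] using hy
        have hyfree : y ∈ (board \ (M ∪ B)).erase x := hfree_erase ▸ hy'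
        have hyx : y ≠ x := (Finset.mem_erase.1 hyfree).1
        have hyF := (Finset.mem_erase.1 hyfree).2
        rw [← Finset.coe_insert]
        have hfree2 : board \ (insert x M ∪ insert y B) = ((board \ (M ∪ B)).erase x).erase y := by
          rw [Finset.union_insert, Finset.sdiff_insert, hfree_erase]
        have hcard : (board \ (insert x M ∪ insert y B)).card < k := by
          rw [hfree2, ← hk]
          exact lt_of_le_of_lt (Finset.card_le_card (Finset.erase_subset _ _))
            (Finset.card_erase_lt_of_mem hx)
        refine ih _ hcard _ _ rfl ?_
        -- The weights of `x` and `y` leave the sum and pay for the sets containing both.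
        have hsum : ∑ z ∈ board \ (M ∪ B), w z
            = w x + (w y + ∑ z ∈ board \ (insert x M ∪ insert y B), w z) := by
          rw [hfree2, Finset.add_sum_erase _ _ hyfree, Finset.add_sum_erase _ _ hx]
        have h1 := makerPotential_step J A M B (y := y) hxM
        have h2 := hmax y hyF
        have h3 := hcodeg x y hyx.symm
        linarith

/-- A weighted form of Beck's criterion for Maker's win. If every two distinct elements `x`, `y`
lie in at most `w x + w y` common sets, and if the total weight is small compared with the number
of sets avoiding any given element, then Maker wins, whoever starts. -/
theorem makerWins_of_codegree_le {board : Finset X} {winning : Set (Set X)} {J : Finset ι}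
    {A : ι → Finset X} (hA : ∀ i ∈ J, A i ⊆ board) (hwin : ∀ i ∈ J, (A i : Set X) ∈ winning)
    {w : X → ℝ} (hw : ∀ x, 0 ≤ w x)
    (hcodeg : ∀ x y, x ≠ y → ((J.filter fun i => x ∈ A i ∧ y ∈ A i).card : ℝ) ≤ w x + w y)
    {s : ℕ} (hs : ∀ i ∈ J, (A i).card ≤ s) {d : ℝ} (hd : 0 ≤ d)
    (hdeg : ∀ x, ((J.filter fun i => x ∈ A i).card : ℝ) ≤ d)
    (hlarge : 2 ^ s * ∑ x ∈ board, w x < J.card - d) :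
    MakerWins (board : Set X) winning := by
  have hterm : ∀ i ∈ J, (1 / 2 : ℝ) ^ s ≤ (1 / 2 : ℝ) ^ (A i).card := fun i hi =>
    pow_le_pow_of_le_one (by norm_num) (by norm_num) (hs i hi)
  have hps : (0 : ℝ) < (1 / 2 : ℝ) ^ s := by positivity
  have hscale : ∑ x ∈ board, w x < (1 / 2 : ℝ) ^ s * (J.card - d) := by
    have h2 : (1 / 2 : ℝ) ^ s * 2 ^ s = 1 := by rw [← mul_pow]; norm_num
    calc ∑ x ∈ board, w x = (1 / 2 : ℝ) ^ s * (2 ^ s * ∑ x ∈ board, w x) := by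
          rw [← mul_assoc, h2, one_mul]
      _ < _ := mul_lt_mul_of_pos_left hlarge hps
  have hT0 : (1 / 2 : ℝ) ^ s * J.card ≤ makerPotential J A ∅ ∅ := by
    unfold makerPotential
    simp only [Finset.disjoint_empty_right, if_true, Finset.sdiff_empty]
    rw [mul_comm, ← nsmul_eq_mul, ← Finset.sum_const]
    exact Finset.sum_le_sum hterm
  have hempty : ((∅ : Finset X) : Set X) = ∅ := Finset.coe_empty
  intro first
  rw [← hempty]
  cases first with
  | maker =>
    refine makerWinsFrom_of_potential hA hwin hw hcodeg _ ∅ ∅ rfl ?_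
    have : (1 / 2 : ℝ) ^ s * (J.card - d) ≤ (1 / 2 : ℝ) ^ s * J.card :=
      mul_le_mul_of_nonneg_left (by linarith) hps.le
    simpa using lt_of_lt_of_le hscale (this.trans hT0)
  | breaker =>
    -- Breaker's first move destroys at most `d` sets; Maker is then on move.
    rcases board.eq_empty_or_nonempty with hb | hb
    · refine makerWinsFrom_of_exhausted hA hwin _ (by simp [hb]) ?_
      refine lt_of_lt_of_le ?_ hT0
      rw [hb, Finset.sum_empty] at hscale
      nlinarith
    · refine MakerWinsFrom.breakerMove _ _ (by simpa using hb) ?_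
      intro y hy
      have hins : insert y ((∅ : Finset X) : Set X) = (({y} : Finset X) : Set X) := by simp
      rw [hins]
      refine makerWinsFrom_of_potential hA hwin hw hcodeg _ ∅ {y} rfl ?_
      have hsub : ∑ x ∈ board \ (∅ ∪ {y}), w x ≤ ∑ x ∈ board, w x :=
        Finset.sum_le_sum_of_subset_of_nonneg Finset.sdiff_subset fun z _ _ => hw z
      refine lt_of_le_of_lt hsub (lt_of_lt_of_le hscale ?_)
      have hsplit := Finset.card_filter_add_card_filter_not (s := J) (fun i => y ∈ A i)
      have hcast : (J.card : ℝ) - d ≤ ((J.filter fun i => y ∉ A i).card : ℝ) := by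
        have h := hdeg y
        have : ((J.filter fun i => y ∈ A i).card : ℝ)
            + ((J.filter fun i => y ∉ A i).card : ℝ) = J.card := by exact_mod_cast hsplit
        linarith
      calc (1 / 2 : ℝ) ^ s * (J.card - d)
          ≤ (1 / 2 : ℝ) ^ s * ((J.filter fun i => y ∉ A i).card : ℝ) :=
            mul_le_mul_of_nonneg_left hcast hps.le
        _ = ∑ i ∈ J.filter (fun i => y ∉ A i), (1 / 2 : ℝ) ^ s := by
            rw [Finset.sum_const, nsmul_eq_mul, mul_comm]
        _ ≤ ∑ i ∈ J.filter (fun i => y ∉ A i), (1 / 2 : ℝ) ^ (A i).card :=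
            Finset.sum_le_sum fun i hi => hterm i (Finset.mem_filter.1 hi).1
        _ = makerPotential J A ∅ {y} := by
            unfold makerPotential
            rw [Finset.sum_filter]
            simp

/-- Two sets are charged for each common element and for each pair of distinct common elements;
`t` bounds the degrees and `v` the codegrees that are considered small. -/
noncomputable def overlapCost (v : X → ℝ) (t : ℝ) (S S' : Finset X) : ℝ :=
  ∑ _x ∈ S ∩ S', 1 / t + ∑ z ∈ (S ∩ S').offDiag, 1 / (v z.1 + v z.2)

lemma overlapCost_nonneg {v : X → ℝ} (hv : ∀ x, 0 < v x) {t : ℝ} (ht : 0 < t)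
    (S S' : Finset X) : 0 ≤ overlapCost v t S S' :=
  add_nonneg (Finset.sum_nonneg fun _ _ => by positivity)
    (Finset.sum_nonneg fun z _ => (one_div_pos.2 (add_pos (hv z.1) (hv z.2))).le)

lemma one_div_le_overlapCost {v : X → ℝ} (hv : ∀ x, 0 < v x) {t : ℝ} (ht : 0 < t)
    {S S' : Finset X} {x : X} (hx : x ∈ S) (hx' : x ∈ S') : 1 / t ≤ overlapCost v t S S' := by
  refine le_add_of_le_of_nonneg ?_
    (Finset.sum_nonneg fun z _ => (one_div_pos.2 (add_pos (hv z.1) (hv z.2))).le)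
  exact Finset.single_le_sum (f := fun _ => 1 / t) (fun _ _ => by positivity)
    (Finset.mem_inter.2 ⟨hx, hx'⟩)

/-- Beck's criterion after a deletion: instead of bounds on all degrees and codegrees it suffices
that the total overlap cost of the family is small, because every set through an element of large
degree, or through a pair of large codegree, has overlap cost at least `1` with the family. -/
theorem makerWins_of_overlapCost {board : Finset X} {winning : Set (Set X)} {J : Finset ι}
    {A : ι → Finset X} {K : Finset X} (hK : K ⊆ board) (hA : ∀ i ∈ J, A i ⊆ K)
    (hwin : ∀ i ∈ J, (A i : Set X) ∈ winning)
    {v : X → ℝ} (hv : ∀ x, 0 < v x) {t : ℝ} (ht : 0 < t)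
    {s : ℕ} (hs : ∀ i ∈ J, (A i).card ≤ s)
    (hlarge : 2 ^ s * ∑ x ∈ K, v x
      < J.card - t - ∑ i ∈ J, ∑ j ∈ J, overlapCost v t (A i) (A j)) :
    MakerWins (board : Set X) winning := by
  classical
  let good : ι → Prop := fun i =>
    (∀ x ∈ A i, ((J.filter fun j => x ∈ A j).card : ℝ) ≤ t) ∧
    ∀ x ∈ A i, ∀ y ∈ A i, x ≠ y →
      ((J.filter fun j => x ∈ A j ∧ y ∈ A j).card : ℝ) ≤ v x + v y
  have hcost : ∀ S S', 0 ≤ overlapCost v t S S' := overlapCost_nonneg hv ht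
  have hbad : ∀ i ∈ J, ¬ good i → 1 ≤ ∑ j ∈ J, overlapCost v t (A i) (A j) := by
    intro i _ hgood
    rw [not_and_or] at hgood
    rcases hgood with h | h
    · push Not at h
      obtain ⟨x, hx, hlt⟩ := h
      calc (1 : ℝ) ≤ ((J.filter fun j => x ∈ A j).card : ℝ) * (1 / t) := by
            rw [mul_one_div, le_div_iff₀ ht]; linarith
        _ = ∑ j ∈ J.filter (fun j => x ∈ A j), 1 / t := by rw [Finset.sum_const, nsmul_eq_mul]
        _ ≤ ∑ j ∈ J.filter (fun j => x ∈ A j), overlapCost v t (A i) (A j) := by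
            exact Finset.sum_le_sum fun j hj =>
              one_div_le_overlapCost hv ht hx (Finset.mem_filter.1 hj).2
        _ ≤ _ := Finset.sum_le_sum_of_subset_of_nonneg (Finset.filter_subset _ _)
            fun j _ _ => hcost _ _
    · push Not at h
      obtain ⟨x, hx, y, hy, hxy, hlt⟩ := h
      have hpos : 0 < v x + v y := add_pos (hv x) (hv y)
      calc (1 : ℝ) ≤ ((J.filter fun j => x ∈ A j ∧ y ∈ A j).card : ℝ) * (1 / (v x + v y)) := by
            rw [mul_one_div, le_div_iff₀ hpos]; linarith
        _ = ∑ j ∈ J.filter (fun j => x ∈ A j ∧ y ∈ A j), 1 / (v x + v y) := by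
            rw [Finset.sum_const, nsmul_eq_mul]
        _ ≤ ∑ j ∈ J.filter (fun j => x ∈ A j ∧ y ∈ A j), overlapCost v t (A i) (A j) := by
            refine Finset.sum_le_sum fun j hj => ?_
            obtain ⟨_, hxj, hyj⟩ := Finset.mem_filter.1 hj
            refine le_add_of_nonneg_of_le (Finset.sum_nonneg fun _ _ => by positivity) ?_
            exact Finset.single_le_sum (f := fun z : X × X => 1 / (v z.1 + v z.2))
              (fun z _ => (one_div_pos.2 (add_pos (hv z.1) (hv z.2))).le) (a := (x, y))
              (Finset.mem_offDiag.2
                ⟨Finset.mem_inter.2 ⟨hx, hxj⟩, Finset.mem_inter.2 ⟨hy, hyj⟩, hxy⟩)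
        _ ≤ _ := Finset.sum_le_sum_of_subset_of_nonneg (Finset.filter_subset _ _)
            fun j _ _ => hcost _ _
  -- Deleting the bad sets leaves a family to which the codegree criterion applies.
  have hcard : (J.card : ℝ) - ∑ i ∈ J, ∑ j ∈ J, overlapCost v t (A i) (A j)
      ≤ ((J.filter good).card : ℝ) := by
    have hsplit := Finset.card_filter_add_card_filter_not (s := J) good
    have hsplit' : ((J.filter good).card : ℝ) + ((J.filter fun i => ¬ good i).card : ℝ)
        = J.card := by
      exact_mod_cast hsplit
    have : ((J.filter fun i => ¬ good i).card : ℝ)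
        ≤ ∑ i ∈ J, ∑ j ∈ J, overlapCost v t (A i) (A j) := by
      calc ((J.filter fun i => ¬ good i).card : ℝ)
          = ∑ i ∈ J.filter (fun i => ¬ good i), (1 : ℝ) := by simp
        _ ≤ ∑ i ∈ J.filter (fun i => ¬ good i), ∑ j ∈ J, overlapCost v t (A i) (A j) :=
            Finset.sum_le_sum fun i hi =>
              hbad i (Finset.mem_filter.1 hi).1 (Finset.mem_filter.1 hi).2
        _ ≤ _ := Finset.sum_le_sum_of_subset_of_nonneg (Finset.filter_subset _ _)
            fun i _ _ => Finset.sum_nonneg fun j _ => hcost _ _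
    linarith
  have hmono : J.filter good ⊆ J := Finset.filter_subset _ _
  refine makerWins_of_codegree_le (J := J.filter good) (A := A)
    (w := fun x => if x ∈ K then v x else 0) (d := t) (s := s)
    (fun i hi => (hA i (hmono hi)).trans hK) (fun i hi => hwin i (hmono hi))
    (fun x => by split_ifs; exacts [(hv x).le, le_rfl]) ?_
    (fun i hi => hs i (hmono hi)) ht.le ?_ ?_
  · intro x y hxy
    rcases ((J.filter good).filter fun i => x ∈ A i ∧ y ∈ A i).eq_empty_or_nonempty with h | h
    · rw [h]
      have h1 := hv x
      have h2 := hv y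
      split_ifs <;> simp <;> linarith
    · obtain ⟨i, hi⟩ := h
      simp only [Finset.mem_filter] at hi
      obtain ⟨⟨hiJ, hgood⟩, hx, hy⟩ := hi
      rw [if_pos (hA i hiJ hx), if_pos (hA i hiJ hy)]
      refine le_trans ?_ (hgood.2 x hx y hy hxy)
      exact_mod_cast Finset.card_le_card (Finset.filter_subset_filter _ hmono)
  · intro x
    rcases ((J.filter good).filter fun i => x ∈ A i).eq_empty_or_nonempty with h | h
    · rw [h]; simpa using ht.le
    · obtain ⟨i, hi⟩ := h
      simp only [Finset.mem_filter] at hi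
      obtain ⟨⟨hiJ, hgood⟩, hx⟩ := hi
      refine le_trans ?_ (hgood.1 x hx)
      exact_mod_cast Finset.card_le_card (Finset.filter_subset_filter _ hmono)
  · have hsum : ∑ x ∈ board, (if x ∈ K then v x else 0) = ∑ x ∈ K, v x := by
      rw [← Finset.sum_filter, Finset.filter_mem_eq_inter, Finset.inter_eq_right.2 hK]
    rw [hsum]
    linarith

end Potential

/-! ### Supersaturation of blow-ups of complete graphs -/

section Supersaturation

variable {V : Type*} [Fintype V]

/-- Resampling one coordinate of a uniformly random function does not change its law. -/
lemma sum_sum_update {I : Type*} [Fintype I] [DecidableEq I] (i : I) (h : (I → V) → ℝ) :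
    ∑ g : I → V, ∑ y : V, h (Function.update g i y) = Fintype.card V * ∑ g : I → V, h g := by
  classical
  rw [← Fintype.sum_prod_type' (f := fun (g : I → V) (y : V) => h (Function.update g i y))]
  have hbij : Function.Involutive
      (fun z : (I → V) × V => (Function.update z.1 i z.2, z.1 i)) := by
    rintro ⟨g, y⟩
    simp
  calc ∑ z : (I → V) × V, h (Function.update z.1 i z.2)
      = ∑ z : (I → V) × V, h z.1 :=
        Equiv.sum_comp hbij.toPerm (fun z : (I → V) × V => h z.1)
    _ = _ := by
        rw [Fintype.sum_prod_type]
        simp [Finset.mul_sum]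

/-- The Cauchy-Schwarz inequality for cloning the coordinate `i`. -/
lemma sq_sum_le_sum_clone {I L : Type*} [Fintype I] [DecidableEq I] [Fintype L] (i : I)
    (f : L → (I → V) → ℝ) :
    (Fintype.card V : ℝ) ^ 2 * (∑ l, ∑ g, f l g) ^ 2
      ≤ (Fintype.card L * (Fintype.card V : ℝ) ^ Fintype.card I) *
        (Fintype.card V * ∑ l, ∑ g, ∑ x, f l g * f l (Function.update g i x)) := by
  classical
  let F : L → (I → V) → ℝ := fun l g => ∑ x, f l (Function.update g i x)
  have hF : ∀ l g y, F l (Function.update g i y) = F l g := fun l g y => by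
    simp [F]
  have h1 : ∀ l, ∑ g, F l g = Fintype.card V * ∑ g, f l g := fun l => sum_sum_update i (f l)
  have h2 : ∀ l, ∑ g, F l g ^ 2
      = Fintype.card V * ∑ g, ∑ x, f l g * f l (Function.update g i x) := by
    intro l
    calc ∑ g, F l g ^ 2 = ∑ g, ∑ y, f l (Function.update g i y) * F l (Function.update g i y) := by
          refine Finset.sum_congr rfl fun g _ => ?_
          simp_rw [hF]
          rw [← Finset.sum_mul, sq]
      _ = Fintype.card V * ∑ g, f l g * F l g := sum_sum_update i (fun g => f l g * F l g)
      _ = _ := by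
          simp only [F, Finset.mul_sum]
  have h3 : (∑ z : L × (I → V), F z.1 z.2) ^ 2
      ≤ (Finset.univ : Finset (L × (I → V))).card * ∑ z : L × (I → V), F z.1 z.2 ^ 2 :=
    sq_sum_le_card_mul_sum_sq
  rw [Fintype.sum_prod_type, Fintype.sum_prod_type] at h3
  simp only [h1, h2] at h3
  rw [← Finset.mul_sum, ← Finset.mul_sum, mul_pow] at h3
  refine h3.trans (le_of_eq ?_)
  simp [Fintype.card_pi]

variable (G : SimpleGraph V)

open Classical in
/-- The maps from a vertex set coloured by `c` to the vertices of `G` that send every two vertices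
of different colours to an edge. -/
noncomputable def crossHoms {U : Type*} [Fintype U] {r : ℕ} (c : U → Fin r) : Finset (U → V) :=
  Finset.univ.filter fun φ => ∀ u u', c u ≠ c u' → G.Adj (φ u) (φ u')

/-- In a graph of minimum degree at least `β |V|`, every set of at most `k` vertices has at least
`(1 - k (1 - β)) |V|` common neighbours. -/
lemma card_common_neighbors_ge [DecidableEq V] [DecidableRel G.Adj] {β : ℝ}
    (hdeg : ∀ x, β * Fintype.card V ≤ (G.degree x : ℝ)) (k : ℕ) (f : Fin k → V) :
    (1 - k * (1 - β)) * Fintype.card V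
      ≤ ((Finset.univ.filter fun x => ∀ i, G.Adj (f i) x).card : ℝ) := by
  classical
  have hsub : (Finset.univ : Finset V) ⊆ (Finset.univ.filter fun x => ∀ i, G.Adj (f i) x) ∪
      Finset.univ.biUnion fun i => (G.neighborFinset (f i))ᶜ := by
    intro x _
    by_cases h : ∀ i, G.Adj (f i) x
    · simp [h]
    · push Not at h
      obtain ⟨i, hi⟩ := h
      simp only [Finset.mem_union, Finset.mem_biUnion]
      exact Or.inr ⟨i, by simp, by simpa using hi⟩
  have h1 := (Finset.card_le_card hsub).trans (Finset.card_union_le _ _)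
  have h2 : (((Finset.univ : Finset (Fin k)).biUnion
      fun i => (G.neighborFinset (f i))ᶜ).card : ℝ) ≤ k * ((1 - β) * Fintype.card V) := by
    calc (((Finset.univ : Finset (Fin k)).biUnion
          fun i => (G.neighborFinset (f i))ᶜ).card : ℝ)
        ≤ ∑ i : Fin k, (((G.neighborFinset (f i))ᶜ).card : ℝ) := by
          exact_mod_cast Finset.card_biUnion_le
      _ ≤ ∑ _i : Fin k, (1 - β) * Fintype.card V := by
          refine Finset.sum_le_sum fun i _ => ?_
          have := hdeg (f i)
          rw [Finset.card_compl, Nat.cast_sub (Finset.card_le_univ _),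
            SimpleGraph.card_neighborFinset_eq_degree]
          linarith
      _ = _ := by simp
  have h3 : (Fintype.card V : ℝ) ≤ ((Finset.univ.filter fun x => ∀ i, G.Adj (f i) x).card : ℝ)
      + (((Finset.univ : Finset (Fin k)).biUnion
          fun i => (G.neighborFinset (f i))ᶜ).card : ℝ) := by
    rw [← Finset.card_univ]
    exact_mod_cast h1
  linarith

/-- Greedy count of labelled cliques in a graph of large minimum degree. -/
lemma card_cliques_ge [DecidableRel G.Adj] {β δ : ℝ} (hδ : 0 ≤ δ)
    (hdeg : ∀ x, β * Fintype.card V ≤ (G.degree x : ℝ)) (k : ℕ)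
    (hk : ∀ j < k, δ ≤ 1 - j * (1 - β)) :
    (δ * Fintype.card V) ^ k ≤ ((crossHoms G (id : Fin k → Fin k)).card : ℝ) := by
  classical
  induction k with
  | zero => simp [crossHoms]
  | succ k ih =>
    have ih' := ih fun j hj => hk j (by omega)
    -- Cliques on `k + 1` vertices are cliques on `k` vertices with a common neighbour added.
    have hcard : ((crossHoms G (id : Fin k → Fin k)).sigma
        fun f => Finset.univ.filter fun x => ∀ i, G.Adj (f i) x).card
        ≤ (crossHoms G (id : Fin (k + 1) → Fin (k + 1))).card := by
      refine Finset.card_le_card_of_injOn (fun z => Fin.snoc (α := fun _ => V) z.1 z.2) ?_ ?_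
      · rintro ⟨f, x⟩ hz
        simp only [Finset.coe_sigma, Set.mem_sigma_iff, Finset.mem_coe, crossHoms,
          Finset.mem_filter, Finset.mem_univ, true_and, id] at hz ⊢
        intro i j
        refine Fin.lastCases ?_ (fun i => ?_) i <;> refine Fin.lastCases ?_ (fun j => ?_) j
        · simp
        · intro _; simpa using (hz.2 j).symm
        · intro _; simpa using hz.2 i
        · intro hij
          simpa using hz.1 i j (fun h => hij (by rw [h]))
      · rintro ⟨f, x⟩ _ ⟨f', x'⟩ _ h
        obtain ⟨h1, h2⟩ := Fin.snoc_injective2 h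
        subst h1; subst h2; rfl
    calc (δ * Fintype.card V) ^ (k + 1)
        = (δ * Fintype.card V) ^ k * (δ * Fintype.card V) := pow_succ _ _
      _ ≤ ((crossHoms G (id : Fin k → Fin k)).card : ℝ) * (δ * Fintype.card V) := by gcongr
      _ = ∑ f ∈ crossHoms G (id : Fin k → Fin k), δ * Fintype.card V := by
          rw [Finset.sum_const, nsmul_eq_mul]
      _ ≤ ∑ f ∈ crossHoms G (id : Fin k → Fin k),
            ((Finset.univ.filter fun x => ∀ i, G.Adj (f i) x).card : ℝ) := by
          refine Finset.sum_le_sum fun f _ => le_trans ?_ (card_common_neighbors_ge G hdeg k f)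
          exact mul_le_mul_of_nonneg_right (hk k (by omega)) (by positivity)
      _ ≤ _ := by
          rw [← Nat.cast_sum, ← Finset.card_sigma]
          exact_mod_cast hcard

/-- Maps of a coloured set that are compatible with a labelled clique: vertices of different colours
are sent to edges, and a vertex of colour `a` can replace the vertex `g a` of the clique `g`. -/
def CliqueCompatible {r m : ℕ} (c : Fin m → Fin r) (φ : Fin m → V) (g : Fin r → V) : Prop :=
  (∀ a b, a ≠ b → G.Adj (g a) (g b)) ∧ (∀ j a, c j ≠ a → G.Adj (φ j) (g a)) ∧
    ∀ j j', c j ≠ c j' → G.Adj (φ j) (φ j')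

lemma CliqueCompatible.cons {V : Type*} (G : SimpleGraph V) {r m : ℕ} {c : Fin (m + 1) → Fin r}
    {φ : Fin m → V} {g : Fin r → V} {x : V} (h : CliqueCompatible G (fun j => c j.succ) φ g)
    (hx : CliqueCompatible G (fun j => c j.succ) φ (Function.update g (c 0) x)) :
    CliqueCompatible G c (Fin.cons x φ : Fin (m + 1) → V) g := by
  have hxg : ∀ a, c 0 ≠ a → G.Adj x (g a) := fun a ha => by
    have := hx.1 (c 0) a ha
    rwa [Function.update_self, Function.update_of_ne ha.symm] at this
  have hxφ : ∀ j : Fin m, c j.succ ≠ c 0 → G.Adj (φ j) x := fun j hj => by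
    have := hx.2.1 j (c 0) hj
    rwa [Function.update_self] at this
  refine ⟨h.1, ?_, ?_⟩
  · intro j a
    refine Fin.cases ?_ (fun j => ?_) j
    · intro ha; simpa using hxg a ha
    · intro ha; simpa using h.2.1 j a ha
  · intro j j'
    refine Fin.cases ?_ (fun j => ?_) j <;> refine Fin.cases ?_ (fun j' => ?_) j'
    · simp
    · intro hj; simpa using (hxφ j' hj.symm).symm
    · intro hj; simpa using hxφ j hj
    · intro hj; simpa using h.2.2 j j' hj

open Classical in
/-- Adding one vertex to the coloured set lowers the density of compatible maps at worst to its square: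
the new vertex is a clone of the clique vertex of its colour. -/
lemma sum_cliqueCompatible_ge [Nonempty V] {r : ℕ} {d : ℝ} (hd : 0 ≤ d)
    (hcl : d * (Fintype.card V : ℝ) ^ r ≤ ((crossHoms G (id : Fin r → Fin r)).card : ℝ)) (m : ℕ)
    (c : Fin m → Fin r) :
    d ^ 2 ^ m * (Fintype.card V : ℝ) ^ (m + r)
      ≤ ∑ φ : Fin m → V, ∑ g : Fin r → V, if CliqueCompatible G c φ g then (1 : ℝ) else 0 := by
  have hN : (0 : ℝ) < Fintype.card V := by exact_mod_cast Fintype.card_pos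
  induction m with
  | zero =>
    refine le_trans (by simpa using hcl) (le_of_eq ?_)
    simp only [CliqueCompatible, crossHoms]
    simp
    congr!
  | succ m ih =>
    set S := ∑ φ : Fin m → V, ∑ g : Fin r → V,
      if CliqueCompatible G (fun j => c j.succ) φ g then (1 : ℝ) else 0 with hS
    have hSge := ih fun j => c j.succ
    rw [← hS] at hSge
    have hCS := sq_sum_le_sum_clone (V := V) (c 0) (fun (φ : Fin m → V) (g : Fin r → V) =>
      if CliqueCompatible G (fun j => c j.succ) φ g then (1 : ℝ) else 0)
    rw [← hS] at hCS
    set T := ∑ φ : Fin m → V, ∑ g : Fin r → V, ∑ x : V,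
      (if CliqueCompatible G (fun j => c j.succ) φ g then (1 : ℝ) else 0) *
      (if CliqueCompatible G (fun j => c j.succ) φ (Function.update g (c 0) x)
        then (1 : ℝ) else 0) with hT
    have hTle : T ≤ ∑ φ : Fin (m + 1) → V, ∑ g : Fin r → V,
        if CliqueCompatible G c φ g then (1 : ℝ) else 0 := by
      rw [← Equiv.sum_comp (Fin.consEquiv fun _ : Fin (m + 1) => V), Fintype.sum_prod_type,
        Finset.sum_comm, hT]
      refine Finset.sum_le_sum fun φ _ => ?_
      rw [Finset.sum_comm]
      refine Finset.sum_le_sum fun x _ => Finset.sum_le_sum fun g _ => ?_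
      by_cases h1 : CliqueCompatible G (fun j => c j.succ) φ g
      · by_cases h2 : CliqueCompatible G (fun j => c j.succ) φ (Function.update g (c 0) x)
        · have := CliqueCompatible.cons G h1 h2
          simp [h1, h2, Fin.consEquiv, this]
        · simp only [h2, if_false, mul_zero]
          split_ifs <;> norm_num
      · simp only [h1, if_false, zero_mul]
        split_ifs <;> norm_num
    refine le_trans ?_ hTle
    have hS0 : 0 ≤ d ^ 2 ^ m * (Fintype.card V : ℝ) ^ (m + r) := by positivity
    have hsq := pow_le_pow_left₀ hS0 hSge 2
    have hcards : (Fintype.card (Fin m → V) : ℝ) * (Fintype.card V : ℝ) ^ Fintype.card (Fin r)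
        = (Fintype.card V : ℝ) ^ (m + r) := by
      simp [Fintype.card_pi, pow_add]
    rw [hcards] at hCS
    have hfin : ((Fintype.card V : ℝ) ^ (m + r) * Fintype.card V) *
        (d ^ 2 ^ (m + 1) * (Fintype.card V : ℝ) ^ (m + 1 + r))
        ≤ ((Fintype.card V : ℝ) ^ (m + r) * Fintype.card V) * T := by
      calc ((Fintype.card V : ℝ) ^ (m + r) * Fintype.card V) *
          (d ^ 2 ^ (m + 1) * (Fintype.card V : ℝ) ^ (m + 1 + r))
          = (Fintype.card V : ℝ) ^ 2 * (d ^ 2 ^ m * (Fintype.card V : ℝ) ^ (m + r)) ^ 2 := by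
            rw [pow_succ 2 m, pow_mul]; ring
        _ ≤ (Fintype.card V : ℝ) ^ 2 * S ^ 2 := by gcongr
        _ ≤ _ := by rw [mul_assoc]; exact hCS
    exact le_of_mul_le_mul_left hfin (by positivity)

/-- A positive density of `r`-cliques forces a positive density of every blow-up of the complete
`r`-partite graph. -/
lemma card_crossHoms_ge [Nonempty V] {r : ℕ} {d : ℝ} (hd : 0 ≤ d)
    (hcl : d * (Fintype.card V : ℝ) ^ r ≤ ((crossHoms G (id : Fin r → Fin r)).card : ℝ))
    {W : Type*} [Fintype W] (c : W → Fin r) :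
    d ^ 2 ^ Fintype.card W * (Fintype.card V : ℝ) ^ Fintype.card W
      ≤ ((crossHoms G c).card : ℝ) := by
  classical
  set m := Fintype.card W
  let e : W ≃ Fin m := Fintype.equivFin W
  have hN : (0 : ℝ) < Fintype.card V := by exact_mod_cast Fintype.card_pos
  have h := sum_cliqueCompatible_ge G hd hcl m (c ∘ e.symm)
  have hle : ∑ φ : Fin m → V, ∑ g : Fin r → V,
      (if CliqueCompatible G (c ∘ e.symm) φ g then (1 : ℝ) else 0)
      ≤ (crossHoms G c).card * (Fintype.card V : ℝ) ^ r := by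
    calc ∑ φ : Fin m → V, ∑ g : Fin r → V,
          (if CliqueCompatible G (c ∘ e.symm) φ g then (1 : ℝ) else 0)
        ≤ ∑ φ : Fin m → V, ∑ _g : Fin r → V, if φ ∘ e ∈ crossHoms G c then (1 : ℝ) else 0 := by
          refine Finset.sum_le_sum fun φ _ => Finset.sum_le_sum fun g _ => ?_
          by_cases h1 : CliqueCompatible G (c ∘ e.symm) φ g
          · have : φ ∘ e ∈ crossHoms G c := by
              simp only [crossHoms, Finset.mem_filter, Finset.mem_univ, true_and]
              intro u u' hu
              exact h1.2.2 (e u) (e u') (by simpa using hu)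
            simp [this, h1]
          · simp only [h1, if_false]
            split_ifs <;> norm_num
      _ = (∑ φ : Fin m → V, if φ ∘ e ∈ crossHoms G c then (1 : ℝ) else 0)
            * (Fintype.card V : ℝ) ^ r := by
          rw [Finset.sum_mul]
          refine Finset.sum_congr rfl fun φ _ => ?_
          split_ifs <;> simp
      _ = (∑ φ : W → V, if φ ∈ crossHoms G c then (1 : ℝ) else 0) * (Fintype.card V : ℝ) ^ r := by
          congr 1
          exact Equiv.sum_comp (e.symm.arrowCongr (Equiv.refl V))
            (fun φ : W → V => if φ ∈ crossHoms G c then (1 : ℝ) else 0)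
      _ = _ := by simp
  have := h.trans hle
  rw [pow_add, ← mul_assoc] at this
  exact le_of_mul_le_mul_right this (by positivity)

/-- Only a fraction `O(1 / |V|)` of all maps is not injective. -/
lemma card_not_injective_le {W : Type*} [Fintype W] [DecidableEq W] [DecidableEq V] :
    (Fintype.card V : ℝ) *
        ((Finset.univ.filter fun φ : W → V => ¬ Function.Injective φ).card : ℝ)
      ≤ (Fintype.card W : ℝ) ^ 2 * (Fintype.card V : ℝ) ^ Fintype.card W := by
  have hpair : ∀ z ∈ (Finset.univ : Finset W).offDiag,
      Fintype.card V * (Finset.univ.filter fun φ : W → V => φ z.1 = φ z.2).card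
        ≤ Fintype.card V ^ Fintype.card W := by
    rintro ⟨a, b⟩ hab
    have hab' : a ≠ b := (Finset.mem_offDiag.1 hab).2.2
    have h : ((Finset.univ : Finset V) ×ˢ
        (Finset.univ.filter fun φ : W → V => φ a = φ b)).card
        ≤ (Finset.univ : Finset (W → V)).card := by
      refine Finset.card_le_card_of_injOn (fun z => Function.update z.2 a z.1) (by simp) ?_
      rintro ⟨y, φ⟩ h ⟨y', φ'⟩ h' heq
      simp only [Finset.coe_product, Set.mem_prod, Finset.mem_coe, Finset.mem_filter,
        Finset.mem_univ, true_and] at h h' heq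
      have hy : y = y' := by simpa using congrFun heq a
      have hoff : ∀ w, w ≠ a → φ w = φ' w := fun w hw => by
        simpa [Function.update_of_ne hw] using congrFun heq w
      refine Prod.ext hy (funext fun w => ?_)
      by_cases hw : w = a
      · subst hw; simp only; rw [h, h']; exact hoff b hab'.symm
      · exact hoff w hw
    simpa [Finset.card_product, Fintype.card_pi] using h
  have hsub : (Finset.univ.filter fun φ : W → V => ¬ Function.Injective φ)
      ⊆ (Finset.univ : Finset W).offDiag.biUnion
        fun z => Finset.univ.filter fun φ : W → V => φ z.1 = φ z.2 := by
    intro φ hφ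
    have hφ' := (Finset.mem_filter.1 hφ).2
    simp only [Function.Injective, not_forall] at hφ'
    obtain ⟨a, b, h, hab⟩ := hφ'
    simp only [Finset.mem_biUnion]
    exact ⟨(a, b), by simpa using hab, by simpa using h⟩
  have hnat : Fintype.card V * (Finset.univ.filter fun φ : W → V => ¬ Function.Injective φ).card
      ≤ Fintype.card W ^ 2 * Fintype.card V ^ Fintype.card W := by
    calc Fintype.card V * (Finset.univ.filter fun φ : W → V => ¬ Function.Injective φ).card
        ≤ Fintype.card V * ∑ z ∈ (Finset.univ : Finset W).offDiag,
            (Finset.univ.filter fun φ : W → V => φ z.1 = φ z.2).card := by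
          gcongr
          exact (Finset.card_le_card hsub).trans Finset.card_biUnion_le
      _ = ∑ z ∈ (Finset.univ : Finset W).offDiag, Fintype.card V *
            (Finset.univ.filter fun φ : W → V => φ z.1 = φ z.2).card := Finset.mul_sum _ _ _
      _ ≤ ∑ z ∈ (Finset.univ : Finset W).offDiag, Fintype.card V ^ Fintype.card W :=
          Finset.sum_le_sum hpair
      _ = (Finset.univ : Finset W).offDiag.card * Fintype.card V ^ Fintype.card W := by
          rw [Finset.sum_const, smul_eq_mul]
      _ ≤ _ := by
          gcongr
          rw [Finset.offDiag_card, Finset.card_univ, sq]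
          exact Nat.sub_le _ _
  exact_mod_cast hnat

/-- An injection pulls back a uniformly random colouring to a uniformly random colouring. -/
lemma card_colorings_le {W : Type*} [Fintype W] [DecidableEq W] [DecidableEq V] {r : ℕ}
    {φ : W → V} (hφ : Function.Injective φ) (c : W → Fin r) :
    r ^ Fintype.card V
      ≤ (Finset.univ.filter fun χ : V → Fin r => χ ∘ φ = c).card * r ^ Fintype.card W := by
  have h : (Finset.univ : Finset (V → Fin r)).card ≤
      ((Finset.univ.filter fun χ : V → Fin r => χ ∘ φ = c) ×ˢ
        (Finset.univ : Finset (W → Fin r))).card := by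
    refine Finset.card_le_card_of_injOn (fun χ => (Function.extend φ c χ, χ ∘ φ)) ?_ ?_
    · intro χ _
      simp only [Finset.coe_product, Set.mem_prod, Finset.mem_coe, Finset.mem_filter,
        Finset.mem_univ, true_and, and_true]
      exact Function.extend_comp hφ c χ
    · intro χ _ χ' _ heq
      obtain ⟨h1, h2⟩ := Prod.mk.inj heq
      funext x
      by_cases hx : ∃ w, φ w = x
      · obtain ⟨w, rfl⟩ := hx
        exact congrFun h2 w
      · have := congrFun h1 x
        rwa [Function.extend_apply' _ _ _ hx, Function.extend_apply' _ _ _ hx] at this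
  simpa [Finset.card_product, Fintype.card_pi] using h

open Classical in
/-- The injective maps that respect the colourings `c` and `χ` and send pairs of different colours
to edges of `G`. -/
noncomputable def colouredEmbeddings {W : Type*} [Fintype W] {r : ℕ} (c : W → Fin r)
    (χ : V → Fin r) : Finset (W → V) :=
  (crossHoms G c).filter fun φ => Function.Injective φ ∧ χ ∘ φ = c

/-- In a large graph with a positive density of `r`-cliques the vertices can be coloured so that a
positive fraction of all maps are coloured embeddings. -/
lemma exists_card_colouredEmbeddings_ge [Nonempty V] {r : ℕ} (hr : 0 < r) {d : ℝ} (hd : 0 ≤ d)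
    (hcl : d * (Fintype.card V : ℝ) ^ r ≤ ((crossHoms G (id : Fin r → Fin r)).card : ℝ))
    {W : Type*} [Fintype W] (c : W → Fin r)
    (hlarge : 2 * (Fintype.card W : ℝ) ^ 2 ≤ d ^ 2 ^ Fintype.card W * Fintype.card V) :
    ∃ χ : V → Fin r, d ^ 2 ^ Fintype.card W / (2 * (r : ℝ) ^ Fintype.card W) *
        (Fintype.card V : ℝ) ^ Fintype.card W ≤ ((colouredEmbeddings G c χ).card : ℝ) := by
  classical
  set v := Fintype.card W
  set N : ℝ := (Fintype.card V : ℝ) with hN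
  have hNpos : 0 < N := by rw [hN]; exact_mod_cast Fintype.card_pos
  have hr' : (0 : ℝ) < r := by exact_mod_cast hr
  set D := d ^ 2 ^ v
  set S := (crossHoms G c).filter Function.Injective with hS
  have hhom : D * N ^ v ≤ ((crossHoms G c).card : ℝ) := card_crossHoms_ge G hd hcl c
  have hSge : D / 2 * N ^ v ≤ (S.card : ℝ) := by
    have hninj := card_not_injective_le (V := V) (W := W)
    have hsplit := Finset.card_filter_add_card_filter_not (s := crossHoms G c) Function.Injective
    have hsplit' : (S.card : ℝ)
        + (((crossHoms G c).filter fun φ => ¬ Function.Injective φ).card : ℝ)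
        = (crossHoms G c).card := by exact_mod_cast hsplit
    have hle : (((crossHoms G c).filter fun φ => ¬ Function.Injective φ).card : ℝ)
        ≤ ((Finset.univ.filter fun φ : W → V => ¬ Function.Injective φ).card : ℝ) := by
      exact_mod_cast Finset.card_le_card (Finset.filter_subset_filter _ (Finset.subset_univ _))
    have hninj' : ((Finset.univ.filter fun φ : W → V => ¬ Function.Injective φ).card : ℝ)
        ≤ D / 2 * N ^ v := by
      refine le_of_mul_le_mul_left (hninj.trans ?_) hNpos
      have : (0 : ℝ) ≤ N ^ v := by positivity
      nlinarith
    linarith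
  have hsum : ∑ _χ : V → Fin r, (S.card : ℝ) / (r : ℝ) ^ v
      ≤ ∑ χ : V → Fin r, ((colouredEmbeddings G c χ).card : ℝ) := by
    have hce : ∀ χ : V → Fin r, ((colouredEmbeddings G c χ).card : ℝ)
        = ∑ φ ∈ S, if χ ∘ φ = c then (1 : ℝ) else 0 := by
      intro χ
      rw [colouredEmbeddings, ← Finset.filter_filter, Finset.card_filter]
      push_cast
      rfl
    simp_rw [hce]
    rw [Finset.sum_comm, Finset.sum_const, Finset.card_univ]
    simp only [Fintype.card_fun, Fintype.card_fin, nsmul_eq_mul]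
    calc ((r ^ Fintype.card V : ℕ) : ℝ) * ((S.card : ℝ) / (r : ℝ) ^ v)
        = ∑ _φ ∈ S, (r : ℝ) ^ Fintype.card V / (r : ℝ) ^ v := by
          rw [Finset.sum_const, nsmul_eq_mul]; push_cast; ring
      _ ≤ _ := by
          refine Finset.sum_le_sum fun φ hφ => ?_
          rw [div_le_iff₀ (by positivity), ← Finset.sum_filter, Finset.sum_const, nsmul_eq_mul,
            mul_one]
          exact_mod_cast card_colorings_le (Finset.mem_filter.1 hφ).2 c
  have : Nonempty (Fin r) := ⟨⟨0, hr⟩⟩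
  obtain ⟨χ, -, hχ⟩ := Finset.exists_le_of_sum_le Finset.univ_nonempty hsum
  refine ⟨χ, le_trans ?_ hχ⟩
  rw [le_div_iff₀ (by positivity)]
  refine le_trans (le_of_eq ?_) hSge
  field_simp

end Supersaturation

/-! ### Colourings that attain the partite 2-density -/

section Density

variable {W : Type*} [Fintype W] {r : ℕ}

open Classical in
/-- The vertices of colour `i` in `U`. -/
noncomputable def colourPart (c : W → Fin r) (i : Fin r) (U : Finset W) : Finset W :=
  U.filter fun w => c w = i

open Classical in
/-- The edges of `H` that join two vertices of colour `i` in `U`. -/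
noncomputable def partEdges (H : SimpleGraph W) (c : W → Fin r) (i : Fin r) (U : Finset W) :
    Finset (Sym2 W) :=
  H.edgeFinset.filter fun e => ∀ w ∈ e, w ∈ colourPart c i U

open Classical in
/-- The edges of `H` with both ends of the same colour. -/
noncomputable def innerEdges (H : SimpleGraph W) (c : W → Fin r) : Finset (Sym2 W) :=
  H.edgeFinset.filter fun e => (e.map c).IsDiag

open Classical in
/-- The edges of `H` inside `U` with both ends of the same colour. -/
noncomputable def innerEdgesIn (H : SimpleGraph W) (c : W → Fin r) (U : Finset W) :
    Finset (Sym2 W) :=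
  (innerEdges H c).filter fun e => ∀ w ∈ e, w ∈ U

lemma le_maxTwoDensity {W : Type*} [Finite W] {H : SimpleGraph W} (H' : H.Subgraph) :
    H'.twoDensity ≤ H.maxTwoDensity :=
  le_ciSup (Set.finite_range fun H' : H.Subgraph => H'.twoDensity).bddAbove H'

/-- The largest 2-density of a finite graph is at least `1` as soon as it is positive. -/
lemma one_le_maxTwoDensity {W : Type*} [Finite W] {H : SimpleGraph W} (h : 0 < H.maxTwoDensity) :
    1 ≤ H.maxTwoDensity := by
  obtain ⟨H', hH'⟩ := exists_lt_of_lt_ciSup (f := fun H' : H.Subgraph => H'.twoDensity) h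
  have hne : H'.edgeSet.Nonempty := by
    by_contra hne
    unfold SimpleGraph.Subgraph.twoDensity at hH'
    split_ifs at hH' with h3
    · rw [Set.not_nonempty_iff_eq_empty.1 hne, Set.ncard_empty] at hH'
      have h3' : (3 : ℝ) ≤ H'.verts.ncard := by exact_mod_cast h3
      have : ((0 : ℕ) - 1 : ℝ) / (H'.verts.ncard - 2) ≤ 0 :=
        div_nonpos_of_nonpos_of_nonneg (by norm_num) (by linarith)
      linarith
    · exact lt_irrefl _ hH'
  obtain ⟨e, he⟩ := hne
  induction e with
  | _ a b =>
    have hab : H.Adj a b := H'.adj_sub he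
    have := le_maxTwoDensity (H.subgraphOfAdj hab)
    have hcard : (H.subgraphOfAdj hab).verts.ncard = 2 := by
      simpa using Set.ncard_pair hab.ne
    have hE : (H.subgraphOfAdj hab).edgeSet.Nonempty := by simp
    unfold SimpleGraph.Subgraph.twoDensity at this
    rwa [if_neg (by omega), if_pos hE] at this

/-- The 2-density of a colour class bounds the number of edges in each of its subsets. -/
lemma partEdges_card_sub_one_le (H : SimpleGraph W) (c : W → Fin r) (i : Fin r) (U : Finset W)
    (h3 : 3 ≤ (colourPart c i U).card) :
    ((partEdges H c i U).card : ℝ) - 1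
      ≤ (H.induce (c ⁻¹' {i})).maxTwoDensity * ((colourPart c i U).card - 2) := by
  classical
  let Hi := H.induce (c ⁻¹' {i})
  let H' : Hi.Subgraph := (⊤ : Hi.Subgraph).induce {w | w.1 ∈ U}
  have hverts : H'.verts.ncard = (colourPart c i U).card := by
    rw [← Set.ncard_coe_finset, ← Set.ncard_image_of_injective _ Subtype.val_injective]
    congr 1
    ext w
    simp [H', colourPart, and_comm]
  have hedges : (partEdges H c i U).card ≤ H'.edgeSet.ncard := by
    rw [← Set.ncard_coe_finset,
      ← Set.ncard_image_of_injective _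
        (Sym2.map.injective (Subtype.val_injective (p := (· ∈ c ⁻¹' {i}))))]
    refine Set.ncard_le_ncard ?_ (Set.toFinite _)
    intro e he
    induction e with
    | _ a b =>
      simp only [partEdges, colourPart, Finset.coe_filter, Set.mem_ofPred_eq,
        SimpleGraph.mem_edgeFinset, SimpleGraph.mem_edgeSet, Sym2.mem_iff, forall_eq_or_imp,
        forall_eq, Finset.mem_filter] at he
      obtain ⟨hab, ⟨haU, hac⟩, hbU, hbc⟩ := he
      refine ⟨s(⟨a, hac⟩, ⟨b, hbc⟩), ?_, by simp⟩
      simp [H', Hi, haU, hbU, hab]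
  have h := le_maxTwoDensity H'
  rw [SimpleGraph.Subgraph.twoDensity, if_pos (by rw [hverts]; exact h3), hverts] at h
  have h3' : (3 : ℝ) ≤ ((colourPart c i U).card : ℝ) := by exact_mod_cast h3
  rw [div_le_iff₀ (by linarith)] at h
  have : ((partEdges H c i U).card : ℝ) ≤ (H'.edgeSet.ncard : ℝ) := by exact_mod_cast hedges
  linarith

/-- A colouring that attains the partite 2-density `m`, which is at least `1` if positive. -/
lemma exists_colouring_partiteTwoDensity (H : SimpleGraph W) (hr : 0 < r)
    (hH : 0 < H.partiteTwoDensity r) :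
    1 ≤ H.partiteTwoDensity r ∧ ∃ c : W → Fin r, ∀ (i : Fin r) (U : Finset W),
      3 ≤ (colourPart c i U).card →
      ((partEdges H c i U).card : ℝ) - 1
        ≤ H.partiteTwoDensity r * ((colourPart c i U).card - 2) := by
  have : Nonempty (Fin r) := ⟨⟨0, hr⟩⟩
  obtain ⟨c, hc⟩ := exists_eq_ciInf_of_finite
    (f := fun c : W → Fin r => ⨆ i : Fin r, (H.induce (c ⁻¹' {i})).maxTwoDensity)
  have hc' : H.partiteTwoDensity r = ⨆ i : Fin r, (H.induce (c ⁻¹' {i})).maxTwoDensity := hc.symm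
  have hle : ∀ i, (H.induce (c ⁻¹' {i})).maxTwoDensity ≤ H.partiteTwoDensity r := fun i => by
    rw [hc']
    exact le_ciSup (Set.finite_range fun i => (H.induce (c ⁻¹' {i})).maxTwoDensity).bddAbove i
  constructor
  · rw [hc'] at hH
    obtain ⟨i, hi⟩ := exists_lt_of_lt_ciSup hH
    exact (one_le_maxTwoDensity hi).trans (hle i)
  · refine ⟨c, fun i U h3 => (partEdges_card_sub_one_le H c i U h3).trans ?_⟩
    have h3' : (3 : ℝ) ≤ ((colourPart c i U).card : ℝ) := by exact_mod_cast h3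
    exact mul_le_mul_of_nonneg_right (hle i) (by linarith)

lemma partEdges_eq_empty (H : SimpleGraph W) (c : W → Fin r) (i : Fin r) (U : Finset W)
    (h : (colourPart c i U).card ≤ 1) : partEdges H c i U = ∅ := by
  classical
  rw [Finset.eq_empty_iff_forall_notMem]
  intro e he
  induction e with
  | _ a b =>
    simp only [partEdges, Finset.mem_filter, SimpleGraph.mem_edgeFinset, SimpleGraph.mem_edgeSet,
      Sym2.mem_iff, forall_eq_or_imp, forall_eq] at he
    exact he.1.ne (Finset.card_le_one.1 h _ he.2.1 _ he.2.2)

lemma partEdges_card_le_one (H : SimpleGraph W) (c : W → Fin r) (i : Fin r) (U : Finset W)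
    (h : (colourPart c i U).card = 2) : (partEdges H c i U).card ≤ 1 := by
  classical
  obtain ⟨a, b, -, hab⟩ := Finset.card_eq_two.1 h
  refine (Finset.card_le_card (t := {s(a, b)}) ?_).trans (by simp)
  intro e he
  induction e with
  | _ x y =>
    simp only [partEdges, Finset.mem_filter, SimpleGraph.mem_edgeFinset, SimpleGraph.mem_edgeSet,
      Sym2.mem_iff, forall_eq_or_imp, forall_eq, hab, Finset.mem_insert,
      Finset.mem_singleton] at he
    obtain ⟨hxy, hx, hy⟩ := he
    have := hxy.ne
    rw [Finset.mem_singleton, Sym2.eq_iff]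
    rcases hx with rfl | rfl <;> rcases hy with rfl | rfl <;> simp_all

lemma innerEdgesIn_card_le (H : SimpleGraph W) (c : W → Fin r) (U : Finset W) :
    (innerEdgesIn H c U).card ≤ ∑ i, (partEdges H c i U).card := by
  classical
  refine (Finset.card_le_card ?_).trans Finset.card_biUnion_le
  intro e he
  induction e with
  | _ a b =>
    simp only [innerEdgesIn, innerEdges, Finset.mem_filter, SimpleGraph.mem_edgeFinset,
      SimpleGraph.mem_edgeSet, Sym2.map_mk, Sym2.mk_isDiag_iff, Sym2.mem_iff,
      forall_eq_or_imp, forall_eq] at he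
    obtain ⟨⟨hab, hc⟩, ha, hb⟩ := he
    simp only [Finset.mem_biUnion, Finset.mem_univ, true_and]
    refine ⟨c a, ?_⟩
    simp only [partEdges, colourPart, Finset.mem_filter, SimpleGraph.mem_edgeFinset,
      SimpleGraph.mem_edgeSet, Sym2.mem_iff, forall_eq_or_imp, forall_eq]
    exact ⟨hab, ⟨ha, trivial⟩, hb, hc.symm⟩

/-- The exponent of the expected number of copies of the inner edges in `U`: a random graph on `n`
vertices with edge probability `n ^ (-l)` contains about `n ^ extensionExponent H c l U` of them. -/
noncomputable def extensionExponent (H : SimpleGraph W) (c : W → Fin r) (l : ℝ) (U : Finset W) :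
    ℝ :=
  U.card - l * (innerEdgesIn H c U).card

/-- The contribution of one colour class to the exponent. -/
noncomputable def partExponent (H : SimpleGraph W) (c : W → Fin r) (l : ℝ) (U : Finset W)
    (i : Fin r) : ℝ :=
  (colourPart c i U).card - l * (partEdges H c i U).card

lemma sum_partExponent_le (H : SimpleGraph W) (c : W → Fin r) {l : ℝ} (hl : 0 ≤ l)
    (U : Finset W) : ∑ i, partExponent H c l U i ≤ extensionExponent H c l U := by
  classical
  unfold partExponent extensionExponent
  rw [Finset.sum_sub_distrib, ← Finset.mul_sum]
  have h1 : (U.card : ℝ) = ∑ i, ((colourPart c i U).card : ℝ) := by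
    rw [← Nat.cast_sum]
    exact_mod_cast Finset.card_eq_sum_card_fiberwise (fun w _ => Finset.mem_univ (c w))
  have h2 : ((innerEdgesIn H c U).card : ℝ) ≤ ∑ i, ((partEdges H c i U).card : ℝ) := by
    exact_mod_cast innerEdgesIn_card_le H c U
  rw [h1]
  have := mul_le_mul_of_nonneg_left h2 hl
  linarith

/-- The hypotheses on the edge probability `n ^ (-l)`: it exceeds `n ^ (-1 / m)` by a factor of at
least `n ^ g`, where the colouring `c` has 2-density at most `m`. -/
structure DensityGap (H : SimpleGraph W) (c : W → Fin r) (m g l : ℝ) : Prop where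
  one_le : 1 ≤ m
  gap_pos : 0 < g
  gap_le : g ≤ 1
  nonneg : 0 ≤ l
  le : l ≤ 1 / m - g
  density : ∀ (i : Fin r) (U : Finset W), 3 ≤ (colourPart c i U).card →
    ((partEdges H c i U).card : ℝ) - 1 ≤ m * ((colourPart c i U).card - 2)

namespace DensityGap

variable {H : SimpleGraph W} {c : W → Fin r} {m g l : ℝ}

lemma le_one_sub (h : DensityGap H c m g l) : l ≤ 1 - g := by
  have : 1 / m ≤ 1 := by
    rw [div_le_one (by linarith [h.one_le])]; exact h.one_le
  linarith [h.le]

lemma partExponent_of_three_le (h : DensityGap H c m g l) {U : Finset W} {i : Fin r}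
    (hU : 3 ≤ (colourPart c i U).card) : 2 - l + g ≤ partExponent H c l U i := by
  have hm := h.one_le
  have hU' : (3 : ℝ) ≤ ((colourPart c i U).card : ℝ) := by exact_mod_cast hU
  have hd := h.density i U hU
  have hl := h.le_one_sub
  have hg := h.gap_pos
  have h0 := h.nonneg
  unfold partExponent
  set k : ℝ := ((colourPart c i U).card : ℝ)
  rcases Nat.lt_or_ge (partEdges H c i U).card 2 with he | he
  · have he' : ((partEdges H c i U).card : ℝ) ≤ 1 := by exact_mod_cast Nat.lt_succ_iff.1 he
    nlinarith [h.gap_le]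
  · have he' : (2 : ℝ) ≤ ((partEdges H c i U).card : ℝ) := by exact_mod_cast he
    set e : ℝ := ((partEdges H c i U).card : ℝ)
    have h1 : l * (e - 1) ≤ (1 / m - g) * (e - 1) :=
      mul_le_mul_of_nonneg_right h.le (by linarith)
    have h2 : 1 / m * (e - 1) ≤ k - 2 := by
      rw [one_div, inv_mul_le_iff₀ (by linarith)]
      exact hd
    nlinarith

lemma partExponent_of_two_le (h : DensityGap H c m g l) {U : Finset W} {i : Fin r}
    (hU : 2 ≤ (colourPart c i U).card) : 2 - l ≤ partExponent H c l U i := by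
  rcases Nat.lt_or_ge 2 (colourPart c i U).card with hU' | hU'
  · linarith [h.partExponent_of_three_le hU', h.gap_pos]
  · have h2 : (colourPart c i U).card = 2 := le_antisymm hU' hU
    have he : ((partEdges H c i U).card : ℝ) ≤ 1 := by
      exact_mod_cast partEdges_card_le_one H c i U h2
    unfold partExponent
    rw [h2]
    have := mul_le_mul_of_nonneg_left he h.nonneg
    push_cast
    linarith

lemma partExponent_of_one_le (h : DensityGap H c m g l) {U : Finset W} {i : Fin r}
    (hU : 1 ≤ (colourPart c i U).card) : 1 ≤ partExponent H c l U i := by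
  rcases Nat.lt_or_ge 1 (colourPart c i U).card with hU' | hU'
  · linarith [h.partExponent_of_two_le hU', h.gap_pos, h.le_one_sub]
  · unfold partExponent
    rw [partEdges_eq_empty H c i U hU', le_antisymm hU' hU]
    simp

lemma partExponent_nonneg (h : DensityGap H c m g l) (U : Finset W) (i : Fin r) :
    0 ≤ partExponent H c l U i := by
  rcases Nat.eq_zero_or_pos (colourPart c i U).card with hU | hU
  · unfold partExponent
    rw [partEdges_eq_empty H c i U (by omega), hU]
    simp
  · linarith [h.partExponent_of_one_le hU]

lemma sum_le_extensionExponent (h : DensityGap H c m g l) (U : Finset W) (I : Finset (Fin r)) :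
    ∑ i ∈ I, partExponent H c l U i ≤ extensionExponent H c l U :=
  (Finset.sum_le_sum_of_subset_of_nonneg (Finset.subset_univ I)
    fun i _ _ => h.partExponent_nonneg U i).trans (sum_partExponent_le H c h.nonneg U)

lemma gap_le_extensionExponent (h : DensityGap H c m g l) {U : Finset W} {a : W} (ha : a ∈ U) :
    g ≤ extensionExponent H c l U := by
  have h1 := h.sum_le_extensionExponent U {c a}
  rw [Finset.sum_singleton] at h1
  have h2 := h.partExponent_of_one_le (U := U) (i := c a)
    (Finset.card_pos.2 ⟨a, by simp [colourPart, ha]⟩)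
  linarith [h.gap_le]

lemma extensionExponent_of_inner (h : DensityGap H c m g l) {U : Finset W} {a b z : W}
    (ha : a ∈ U) (hb : b ∈ U) (hz : z ∈ U) (hab : a ≠ b) (hza : z ≠ a) (hzb : z ≠ b)
    (hc : c a = c b) : 2 - l + g ≤ extensionExponent H c l U := by
  classical
  by_cases hcz : c z = c a
  · have h1 := h.sum_le_extensionExponent U {c a}
    rw [Finset.sum_singleton] at h1
    refine (h.partExponent_of_three_le ?_).trans h1
    refine le_trans (Finset.card_eq_three.2 ⟨a, b, z, hab, hza.symm, hzb.symm, rfl⟩).ge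
      (Finset.card_le_card ?_)
    intro w hw
    simp only [Finset.mem_insert, Finset.mem_singleton] at hw
    rcases hw with rfl | rfl | rfl <;> simp [colourPart, *]
  · have h1 := h.sum_le_extensionExponent U {c a, c z}
    rw [Finset.sum_pair (Ne.symm hcz)] at h1
    have h2 := h.partExponent_of_two_le (U := U) (i := c a) (by
      refine le_trans (Finset.card_pair hab).ge (Finset.card_le_card ?_)
      intro w hw
      simp only [Finset.mem_insert, Finset.mem_singleton] at hw
      rcases hw with rfl | rfl <;> simp [colourPart, *])
    have h3 := h.partExponent_of_one_le (U := U) (i := c z)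
      (Finset.card_pos.2 ⟨z, by simp [colourPart, hz]⟩)
    linarith [h.gap_le]

lemma extensionExponent_of_cross (h : DensityGap H c m g l) {U : Finset W} {a b z : W}
    (ha : a ∈ U) (hb : b ∈ U) (hz : z ∈ U) (hza : z ≠ a) (hzb : z ≠ b)
    (hc : c a ≠ c b) : 2 + g ≤ extensionExponent H c l U := by
  classical
  have hone : ∀ w ∈ U, 1 ≤ partExponent H c l U (c w) := fun w hw =>
    h.partExponent_of_one_le (Finset.card_pos.2 ⟨w, by simp [colourPart, hw]⟩)
  have htwo : ∀ w ∈ U, ∀ w' ∈ U, w ≠ w' → c w = c w' → 1 + g ≤ partExponent H c l U (c w') := by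
    intro w hw w' hw' hne hcw
    have := h.partExponent_of_two_le (U := U) (i := c w') (by
      refine le_trans (Finset.card_pair hne).ge (Finset.card_le_card ?_)
      intro u hu
      simp only [Finset.mem_insert, Finset.mem_singleton] at hu
      rcases hu with rfl | rfl <;> simp [colourPart, *])
    linarith [h.le_one_sub]
  have h1 := h.sum_le_extensionExponent U {c a, c b}
  rw [Finset.sum_pair hc] at h1
  by_cases hcza : c z = c a
  · linarith [htwo z hz a ha hza hcza, hone b hb]
  by_cases hczb : c z = c b
  · linarith [htwo z hz b hb hzb hczb, hone a ha]
  have h3 := h.sum_le_extensionExponent U {c z, c a, c b}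
  rw [Finset.sum_insert (by simp [hcza, hczb]), Finset.sum_pair hc] at h3
  linarith [hone z hz, hone a ha, hone b hb, h.gap_le]

end DensityGap

end Density

/-! ### Inclusion probabilities in the binomial random graph -/

section Probability

open MeasureTheory

instance SimpleGraph.instMeasurableSingletonClass {V : Type*} [Countable V] :
    MeasurableSingletonClass (SimpleGraph V) where
  measurableSet_singleton G := by
    have h : ({G} : Set (SimpleGraph V)) = SimpleGraph.edgeSet ⁻¹' {G.edgeSet} := by
      ext R
      simp
    rw [h]
    exact SimpleGraph.measurable_edgeSet (measurableSet_singleton _)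

/-- The binomial random graph contains a fixed set of `k` edges with probability `p ^ k`. -/
lemma binomialRandom_real_subset {V : Type*} [Finite V] (p : unitInterval) (S : Finset (Sym2 V))
    (hS : ∀ e ∈ S, ¬ e.IsDiag) :
    (SimpleGraph.binomialRandom V p).real {R | (S : Set (Sym2 V)) ⊆ R.edgeSet}
      = (p : ℝ) ^ S.card := by
  classical
  have hpre : SimpleGraph.fromEdgeSet ⁻¹' {R : SimpleGraph V | (S : Set (Sym2 V)) ⊆ R.edgeSet}
      = {T | (S : Set (Sym2 V)) ⊆ T} := by
    ext T
    simp only [Set.mem_preimage, Set.mem_ofPred_eq, SimpleGraph.edgeSet_fromEdgeSet]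
    refine ⟨fun h e he => (h he).1, fun h e he => ⟨h he, ?_⟩⟩
    simpa using hS e he
  have hpi : (fun p : Sym2 V → Prop => {i | p i}) ⁻¹' {T | (S : Set (Sym2 V)) ⊆ T}
      = Set.pi S fun _ => {True} := by
    ext f
    simp only [Set.mem_preimage, Set.mem_ofPred_eq, Set.mem_pi, Set.mem_singleton_iff, eq_iff_iff,
      iff_true]
    rfl
  rw [measureReal_def, SimpleGraph.binomialRandom_eq_map,
    Measure.map_apply SimpleGraph.measurable_fromEdgeSet (Set.toFinite _).measurableSet, hpre,
    ProbabilityTheory.setBernoulli_apply', hpi, Measure.infinitePi_pi _ (by simp)]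
  rw [Finset.prod_congr rfl (g := fun _ => ((unitInterval.toNNReal p : NNReal) : ENNReal))]
  · simp
  · intro e he
    have := hS e he
    simp [this]

/-- The indicator of the event that `S` consists of edges of `R`. -/
noncomputable def containsIndicator {V : Type*} (S : Finset (Sym2 V)) (R : SimpleGraph V) : ℝ :=
  Set.indicator {R : SimpleGraph V | (S : Set (Sym2 V)) ⊆ R.edgeSet} 1 R

lemma containsIndicator_mul {V : Type*} [DecidableEq V] (S S' : Finset (Sym2 V))
    (R : SimpleGraph V) :
    containsIndicator S R * containsIndicator S' R = containsIndicator (S ∪ S') R := by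
  classical
  simp only [containsIndicator, Set.indicator_apply, Set.mem_ofPred_eq, Finset.coe_union,
    Set.union_subset_iff, Pi.one_apply]
  split_ifs <;> simp_all

lemma containsIndicator_nonneg {V : Type*} (S : Finset (Sym2 V)) (R : SimpleGraph V) :
    0 ≤ containsIndicator S R :=
  Set.indicator_nonneg (fun _ _ => zero_le_one) R

lemma integral_containsIndicator {V : Type*} [Finite V] (p : unitInterval) (S : Finset (Sym2 V))
    (hS : ∀ e ∈ S, ¬ e.IsDiag) :
    ∫ R, containsIndicator S R ∂(SimpleGraph.binomialRandom V p) = (p : ℝ) ^ S.card := by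
  rw [← binomialRandom_real_subset p S hS]
  exact integral_indicator_one (Set.toFinite _).measurableSet

end Probability

/-! ### Copies of `H` and their overlaps -/

section Copies

variable {V W : Type*} [Fintype W] {r : ℕ}

open Classical in
/-- The edges of the copy of `H` given by `φ`. -/
noncomputable def copyEdges (H : SimpleGraph W) (φ : W → V) : Finset (Sym2 V) :=
  H.edgeFinset.image (Sym2.map φ)

open Classical in
/-- The edges of the copy of `H` given by `φ` that the random graph has to provide. -/
noncomputable def innerCopyEdges (H : SimpleGraph W) (c : W → Fin r) (φ : W → V) :
    Finset (Sym2 V) :=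
  (innerEdges H c).image (Sym2.map φ)

open Classical in
/-- The vertices that the map `φ` sends into the range of `ψ`. -/
noncomputable def overlap (φ ψ : W → V) : Finset W :=
  Finset.univ.filter fun w => φ w ∈ Set.range ψ

open Classical in
/-- The maps are weighted by the overlap with `ψ`: a vertex sent into the range of `ψ` gains a
factor `|V|` but has only `|W|` possible images, so each vertex contributes at most `(|W| + 1) |V|`. -/
lemma sum_pow_card_overlap_le [Fintype V] (ψ : W → V) :
    ∑ φ : W → V, (Fintype.card V : ℝ) ^ (overlap φ ψ).card
      ≤ ((Fintype.card W + 1) * (Fintype.card V : ℝ)) ^ Fintype.card W := by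
  classical
  have h1 : ∀ φ : W → V, (Fintype.card V : ℝ) ^ (overlap φ ψ).card
      = ∏ w, if φ w ∈ Set.range ψ then (Fintype.card V : ℝ) else 1 := by
    intro φ
    rw [Finset.prod_ite, Finset.prod_const, Finset.prod_const_one, mul_one, overlap]
  have h2 : ∑ x : V, (if x ∈ Set.range ψ then (Fintype.card V : ℝ) else 1)
      ≤ (Fintype.card W + 1) * (Fintype.card V : ℝ) := by
    have hle : ∀ x : V, (if x ∈ Set.range ψ then (Fintype.card V : ℝ) else 1)
        ≤ (if x ∈ Finset.univ.image ψ then (Fintype.card V : ℝ) else 0) + 1 := by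
      intro x
      by_cases hx : x ∈ Set.range ψ
      · have : x ∈ Finset.univ.image ψ := by simpa using hx
        simp [hx, this]
      · rw [if_neg hx]
        have : 0 ≤ (if x ∈ Finset.univ.image ψ then (Fintype.card V : ℝ) else 0) := by
          split_ifs <;> positivity
        linarith
    refine (Finset.sum_le_sum fun x _ => hle x).trans ?_
    rw [Finset.sum_add_distrib, ← Finset.sum_filter, Finset.filter_mem_eq_inter,
      Finset.univ_inter, Finset.sum_const, nsmul_eq_mul]
    have : ((Finset.univ.image ψ).card : ℝ) ≤ Fintype.card W := by
      exact_mod_cast Finset.card_image_le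
    have h0 : (0 : ℝ) ≤ Fintype.card V := by positivity
    have := mul_le_mul_of_nonneg_right this h0
    simp only [Finset.sum_const, Finset.card_univ, nsmul_eq_mul, mul_one]
    linarith
  simp_rw [h1]
  have h3 := Finset.prod_univ_sum (fun _ : W => (Finset.univ : Finset V))
    (fun _ x => if x ∈ Set.range ψ then (Fintype.card V : ℝ) else 1)
  rw [Fintype.piFinset_univ] at h3
  rw [← h3]
  refine (Finset.prod_le_prod (fun _ _ => Finset.sum_nonneg fun x _ => ?_) fun _ _ => h2).trans ?_
  · split_ifs <;> positivity
  · simp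

lemma mem_colouredEmbeddings [Fintype V] {G : SimpleGraph V} {c : W → Fin r} {χ : V → Fin r}
    {φ : W → V} :
    φ ∈ colouredEmbeddings G c χ ↔
      (∀ u u', c u ≠ c u' → G.Adj (φ u) (φ u')) ∧ Function.Injective φ ∧ χ ∘ φ = c := by
  simp [colouredEmbeddings, crossHoms]

lemma card_innerCopyEdges {H : SimpleGraph W} {c : W → Fin r} {φ : W → V}
    (hφ : Function.Injective φ) : (innerCopyEdges H c φ).card = (innerEdges H c).card := by
  classical
  exact Finset.card_image_of_injective _ (Sym2.map.injective hφ)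

open Classical in
lemma card_copyEdges_le (H : SimpleGraph W) (φ : W → V) :
    (copyEdges H φ).card ≤ H.edgeFinset.card :=
  Finset.card_image_le

lemma innerCopyEdges_subset (H : SimpleGraph W) (c : W → Fin r) (φ : W → V) :
    innerCopyEdges H c φ ⊆ copyEdges H φ := by
  classical
  exact Finset.image_subset_image (Finset.filter_subset _ _)

lemma not_isDiag_of_mem_innerCopyEdges {H : SimpleGraph W} {c : W → Fin r} {φ : W → V}
    (hφ : Function.Injective φ) {e : Sym2 V} (he : e ∈ innerCopyEdges H c φ) : ¬ e.IsDiag := by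
  classical
  simp only [innerCopyEdges, innerEdges, Finset.mem_image, Finset.mem_filter] at he
  obtain ⟨f, ⟨hf, -⟩, rfl⟩ := he
  induction f with
  | _ a b =>
    rw [SimpleGraph.mem_edgeFinset, SimpleGraph.mem_edgeSet] at hf
    simpa using hφ.ne hf.ne

/-- An edge shared by two copies is the image of an edge with both ends in the overlap. -/
lemma exists_adj_of_mem_copyEdges {H : SimpleGraph W} {φ ψ : W → V} {x : Sym2 V}
    (hx : x ∈ copyEdges H φ) (hx' : x ∈ copyEdges H ψ) :
    ∃ a b, H.Adj a b ∧ a ∈ overlap φ ψ ∧ b ∈ overlap φ ψ ∧ x = s(φ a, φ b) := by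
  classical
  simp only [copyEdges, Finset.mem_image] at hx hx'
  obtain ⟨f, hf, rfl⟩ := hx
  obtain ⟨f', hf', hff'⟩ := hx'
  induction f with
  | _ a b =>
    induction f' with
    | _ a' b' =>
      rw [SimpleGraph.mem_edgeFinset, SimpleGraph.mem_edgeSet] at hf
      rw [Sym2.map_mk, Sym2.map_mk, Sym2.eq_iff] at hff'
      refine ⟨a, b, hf, ?_, ?_, rfl⟩ <;> simp only [overlap, Finset.mem_filter, Finset.mem_univ,
        true_and, Set.mem_range] <;> rcases hff' with ⟨h1, h2⟩ | ⟨h1, h2⟩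
      exacts [⟨a', h1⟩, ⟨b', h2⟩, ⟨b', h2⟩, ⟨a', h1⟩]

open Classical in
lemma card_inter_innerCopyEdges_le {H : SimpleGraph W} {c : W → Fin r}
    {φ ψ : W → V} (hφ : Function.Injective φ) :
    (innerCopyEdges H c φ ∩ innerCopyEdges H c ψ).card
      ≤ (innerEdgesIn H c (overlap φ ψ)).card := by
  classical
  rw [← Finset.card_image_of_injective (innerEdgesIn H c (overlap φ ψ)) (Sym2.map.injective hφ)]
  refine Finset.card_le_card fun x hx => ?_
  obtain ⟨hx1, hx2⟩ := Finset.mem_inter.1 hx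
  obtain ⟨a, b, -, ha, hb, hxab⟩ := exists_adj_of_mem_copyEdges
    (innerCopyEdges_subset H c φ hx1) (innerCopyEdges_subset H c ψ hx2)
  obtain ⟨f, hf, hfx⟩ := Finset.mem_image.1 hx1
  have hfab : f = s(a, b) := Sym2.map.injective hφ (by rw [hfx, hxab, Sym2.map_mk])
  refine Finset.mem_image.2 ⟨f, ?_, hfx⟩
  subst hfab
  simp only [innerEdgesIn, Finset.mem_filter, Sym2.mem_iff, forall_eq_or_imp, forall_eq]
  exact ⟨hf, ha, hb⟩

open Classical in
/-- The exponent of the number of pairs that can serve as the edge `x`: all pairs are available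
between different colours, only `n ^ (2 - l)` random ones inside a colour class. -/
noncomputable def edgeExponent (χ : V → Fin r) (l : ℝ) (x : Sym2 V) : ℝ :=
  if (x.map χ).IsDiag then 2 - l else 2

/-- Two distinct edges span at least three vertices. -/
lemma exists_third_vertex {W : Type*} {a b a' b' : W} (hab : a' ≠ b') (hne : s(a, b) ≠ s(a', b')) :
    (a' ≠ a ∧ a' ≠ b) ∨ (b' ≠ a ∧ b' ≠ b) := by
  by_contra hcon
  push Not at hcon
  obtain ⟨h1, h2⟩ := hcon
  refine hne (Sym2.eq_iff.2 ?_)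
  by_cases haa : a' = a
  · subst haa
    exact Or.inl ⟨rfl, (h2 hab.symm).symm⟩
  · have hab' := h1 haa
    subst hab'
    by_cases hba : b' = a
    · exact Or.inr ⟨hba.symm, rfl⟩
    · exact absurd (h2 hba).symm hab

/-- If two copies share two distinct edges, then the exponent of their overlap exceeds the smaller
exponent of the two edges by the gap `g`. -/
lemma edgeExponent_add_gap_le [Fintype V] {G : SimpleGraph V} {H : SimpleGraph W} {c : W → Fin r}
    {χ : V → Fin r} {m g l : ℝ} (h : DensityGap H c m g l) {φ ψ : W → V}
    (hφ : φ ∈ colouredEmbeddings G c χ) {x y : Sym2 V}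
    (hx : x ∈ copyEdges H φ) (hx' : x ∈ copyEdges H ψ)
    (hy : y ∈ copyEdges H φ) (hy' : y ∈ copyEdges H ψ) (hxy : x ≠ y) :
    edgeExponent χ l x + g ≤ extensionExponent H c l (overlap φ ψ) ∨
      edgeExponent χ l y + g ≤ extensionExponent H c l (overlap φ ψ) := by
  classical
  obtain ⟨-, -, hχ⟩ := mem_colouredEmbeddings.1 hφ
  have hχ' : ∀ w, χ (φ w) = c w := fun w => congrFun hχ w
  obtain ⟨a, b, hab, ha, hb, rfl⟩ := exists_adj_of_mem_copyEdges hx hx'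
  obtain ⟨a', b', hab', ha', hb', rfl⟩ := exists_adj_of_mem_copyEdges hy hy'
  have hne : s(a, b) ≠ s(a', b') := fun heq => hxy (by
    have := congrArg (Sym2.map φ) heq
    simpa only [Sym2.map_mk] using this)
  obtain ⟨z, hz, hza, hzb⟩ : ∃ z ∈ overlap φ ψ, z ≠ a ∧ z ≠ b := by
    rcases exists_third_vertex hab'.ne hne with hz | hz
    exacts [⟨a', ha', hz⟩, ⟨b', hb', hz⟩]
  obtain ⟨z', hz', hza', hzb'⟩ : ∃ z ∈ overlap φ ψ, z ≠ a' ∧ z ≠ b' := by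
    rcases exists_third_vertex hab.ne hne.symm with hz | hz
    exacts [⟨a, ha, hz⟩, ⟨b, hb, hz⟩]
  simp only [edgeExponent, Sym2.map_mk, Sym2.mk_isDiag_iff, hχ']
  by_cases hc : c a = c b
  · left
    rw [if_pos hc]
    exact h.extensionExponent_of_inner ha hb hz hab.ne hza hzb hc
  · by_cases hc' : c a' = c b'
    · right
      rw [if_pos hc']
      exact h.extensionExponent_of_inner ha' hb' hz' hab'.ne hza' hzb' hc'
    · left
      rw [if_neg hc]
      exact h.extensionExponent_of_cross ha hb hz hza hzb hc

end Copies

/-! ### The deterministic winning condition on the random graph -/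

section Winning

variable {V W : Type*} [Fintype V] [Fintype W] {r : ℕ}

/-- The codegree allowance of a pair `x` of vertices when `M` copies are expected: up to the factor
`n ^ (-g / 2)` it is the average number of copies through a pair of the same type. -/
noncomputable def edgeWeight (χ : V → Fin r) (g l M : ℝ) (x : Sym2 V) : ℝ :=
  M * (Fintype.card V : ℝ) ^ (-(g / 2) - edgeExponent χ l x)

/-- The number of coloured copies of `H` whose inner edges are present in `R`. -/
noncomputable def copyNumber (G : SimpleGraph V) (H : SimpleGraph W) (c : W → Fin r)
    (χ : V → Fin r) (R : SimpleGraph V) : ℝ :=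
  ∑ φ ∈ colouredEmbeddings G c χ, containsIndicator (innerCopyEdges H c φ) R

open Classical in
/-- The total overlap cost of the coloured copies of `H` whose inner edges are present in `R`. -/
noncomputable def totalOverlapCost (G : SimpleGraph V) (H : SimpleGraph W) (c : W → Fin r)
    (χ : V → Fin r) (g l M : ℝ) (R : SimpleGraph V) : ℝ :=
  ∑ φ ∈ colouredEmbeddings G c χ, ∑ ψ ∈ colouredEmbeddings G c χ,
    overlapCost (edgeWeight χ g l M) (M / 4) (copyEdges H φ) (copyEdges H ψ) *
      containsIndicator (innerCopyEdges H c φ ∪ innerCopyEdges H c ψ) R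

open Classical in
/-- A bound for the total weight of the edges that are used by copies: all pairs between different
colours and the edges of `R`. -/
noncomputable def totalWeight (g l M : ℝ) (R : SimpleGraph V) : ℝ :=
  M * (Fintype.card V : ℝ) ^ (-(g / 2)) +
    ∑ x ∈ Finset.univ.filter (fun x : Sym2 V => ¬ x.IsDiag),
      M * (Fintype.card V : ℝ) ^ (-(g / 2) - (2 - l)) * containsIndicator {x} R

lemma containsIndicator_eq_ite {V : Type*} (S : Finset (Sym2 V)) (R : SimpleGraph V)
    [Decidable ((S : Set (Sym2 V)) ⊆ R.edgeSet)] :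
    containsIndicator S R = if (S : Set (Sym2 V)) ⊆ R.edgeSet then 1 else 0 := by
  classical
  simp only [containsIndicator, Set.indicator_apply, Set.mem_ofPred_eq, Pi.one_apply]

lemma edgeWeight_pos [Nonempty V] (χ : V → Fin r) (g l : ℝ) {M : ℝ} (hM : 0 < M) (x : Sym2 V) :
    0 < edgeWeight χ g l M x := by
  have hN : (0 : ℝ) < Fintype.card V := by exact_mod_cast Fintype.card_pos
  unfold edgeWeight
  positivity

/-- The cross edges are provided by `G` and the inner edges by `R`. -/
lemma coe_copyEdges_mem_copyEdgeSets {G R : SimpleGraph V} {H : SimpleGraph W} {c : W → Fin r}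
    {χ : V → Fin r} {φ : W → V} (hφ : φ ∈ colouredEmbeddings G c χ)
    (hR : (innerCopyEdges H c φ : Set (Sym2 V)) ⊆ R.edgeSet) :
    (copyEdges H φ : Set (Sym2 V)) ∈ H.copyEdgeSets (G ⊔ R) := by
  classical
  obtain ⟨hcross, hinj, -⟩ := mem_colouredEmbeddings.1 hφ
  let f : H →g G ⊔ R :=
    { toFun := φ
      map_rel' := by
        intro a b hab
        by_cases hc : c a = c b
        · right
          have : s(φ a, φ b) ∈ R.edgeSet := hR (by
            simp only [innerCopyEdges, innerEdges, Finset.coe_image, Set.mem_image, Finset.mem_coe,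
              Finset.mem_filter]
            exact ⟨s(a, b), ⟨by simpa using hab, by simpa using hc⟩, by simp⟩)
          simpa using this
        · left
          exact hcross a b hc }
  refine ⟨⟨f, hinj⟩, ?_⟩
  ext e
  simp only [SimpleGraph.Copy.toSubgraph, SimpleGraph.Subgraph.edgeSet_map,
    SimpleGraph.Subgraph.edgeSet_top, copyEdges, Finset.coe_image, SimpleGraph.coe_edgeFinset]
  rfl

lemma card_sym2_le_sq [Nonempty V] :
    (Fintype.card (Sym2 V) : ℝ) ≤ (Fintype.card V : ℝ) ^ 2 := by
  classical
  have h : Fintype.card (Sym2 V) ≤ Fintype.card (V × V) :=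
    Fintype.card_le_of_surjective (Sym2.mk.uncurry) (fun e => by
      induction e with
      | _ a b => exact ⟨(a, b), rfl⟩)
  rw [Fintype.card_prod] at h
  rw [sq]
  exact_mod_cast h

open Classical in
lemma sum_edgeWeight_le [Nonempty V] {R : SimpleGraph V} {χ : V → Fin r} {g l M : ℝ} (hM : 0 < M)
    (K : Finset (Sym2 V)) (hK : ∀ x ∈ K, (x.map χ).IsDiag → x ∈ R.edgeSet) :
    ∑ x ∈ K, edgeWeight χ g l M x ≤ totalWeight g l M R := by
  have hN : (0 : ℝ) < Fintype.card V := by exact_mod_cast Fintype.card_pos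
  have hpt : ∀ x ∈ K, edgeWeight χ g l M x ≤ M * (Fintype.card V : ℝ) ^ (-(g / 2) - 2) +
      if x ∈ R.edgeSet then M * (Fintype.card V : ℝ) ^ (-(g / 2) - (2 - l)) else 0 := by
    intro x hx
    unfold edgeWeight edgeExponent
    by_cases hd : (x.map χ).IsDiag
    · rw [if_pos hd, if_pos (hK x hx hd)]
      exact le_add_of_nonneg_left (by positivity)
    · rw [if_neg hd]
      refine le_add_of_nonneg_right ?_
      split_ifs <;> positivity
  refine (Finset.sum_le_sum hpt).trans ?_
  rw [Finset.sum_add_distrib]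
  refine add_le_add ?_ ?_
  · rw [Finset.sum_const, nsmul_eq_mul]
    have h1 : (K.card : ℝ) ≤ (Fintype.card V : ℝ) ^ 2 := by
      refine le_trans ?_ (card_sym2_le_sq (V := V))
      exact_mod_cast Finset.card_le_univ K
    have h2 : (Fintype.card V : ℝ) ^ (-(g / 2) - 2) * (Fintype.card V : ℝ) ^ 2
        = (Fintype.card V : ℝ) ^ (-(g / 2)) := by
      rw [← Real.rpow_natCast, ← Real.rpow_add hN]
      congr 1
      push_cast
      ring
    calc (K.card : ℝ) * (M * (Fintype.card V : ℝ) ^ (-(g / 2) - 2))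
        ≤ (Fintype.card V : ℝ) ^ 2 * (M * (Fintype.card V : ℝ) ^ (-(g / 2) - 2)) := by gcongr
      _ = M * ((Fintype.card V : ℝ) ^ (-(g / 2) - 2) * (Fintype.card V : ℝ) ^ 2) := by ring
      _ = _ := by rw [h2]
  · refine le_trans (Finset.sum_le_univ_sum_of_nonneg fun x => by split_ifs <;> positivity) ?_
    rw [Finset.sum_filter]
    refine Finset.sum_le_sum fun x _ => ?_
    by_cases hx : x ∈ R.edgeSet
    · have hnd : ¬ x.IsDiag := R.not_isDiag_of_mem_edgeSet hx
      rw [if_pos hx, if_pos hnd, containsIndicator_eq_ite, if_pos (by simpa using hx), mul_one]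
    · rw [if_neg hx]
      split_ifs
      · exact le_rfl
      · exact mul_nonneg (by positivity) (containsIndicator_nonneg _ _)

open Classical in
/-- Maker wins if there are many coloured copies, with small total overlap cost, and if the total
weight of the edges is small. -/
lemma makerWinsHGame_of_counts [Nonempty V] {G R : SimpleGraph V} {H : SimpleGraph W}
    {c : W → Fin r} {χ : V → Fin r} {g l M : ℝ} (hM : 0 < M)
    (h : 2 ^ H.edgeFinset.card * totalWeight g l M R
      < copyNumber G H c χ R - M / 4 - totalOverlapCost G H c χ g l M R) :
    H.MakerWinsHGame (G ⊔ R) := by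
  set Φ := colouredEmbeddings G c χ with hΦ
  set J := Φ.filter fun φ => (innerCopyEdges H c φ : Set (Sym2 V)) ⊆ R.edgeSet with hJ
  have hJmem : ∀ φ ∈ J, φ ∈ Φ ∧ (innerCopyEdges H c φ : Set (Sym2 V)) ⊆ R.edgeSet :=
    fun φ hφ => Finset.mem_filter.1 hφ
  have hcopy : copyNumber G H c χ R = J.card := by
    unfold copyNumber
    simp_rw [containsIndicator_eq_ite]
    rw [← Finset.sum_filter]
    simp [hJ, hΦ]
  have hcost : totalOverlapCost G H c χ g l M R = ∑ φ ∈ J, ∑ ψ ∈ J,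
      overlapCost (edgeWeight χ g l M) (M / 4) (copyEdges H φ) (copyEdges H ψ) := by
    unfold totalOverlapCost
    rw [hJ, Finset.sum_filter]
    refine Finset.sum_congr rfl fun φ _ => ?_
    simp_rw [← containsIndicator_mul, containsIndicator_eq_ite]
    split_ifs with hφ
    · rw [Finset.sum_filter]
      refine Finset.sum_congr rfl fun ψ _ => ?_
      split_ifs <;> simp
    · simp
  set K := J.biUnion fun φ => copyEdges H φ with hK
  have hsub : ∀ φ ∈ J, (copyEdges H φ : Set (Sym2 V)) ⊆ (G ⊔ R).edgeSet := by
    intro φ hφ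
    obtain ⟨f, hf⟩ := coe_copyEdges_mem_copyEdgeSets (hJmem φ hφ).1 (hJmem φ hφ).2
    rw [← hf]
    exact SimpleGraph.Subgraph.edgeSet_subset _
  have hboard : (((G ⊔ R).edgeFinset : Finset (Sym2 V)) : Set (Sym2 V)) = (G ⊔ R).edgeSet :=
    SimpleGraph.coe_edgeFinset _
  have hKR : ∀ x ∈ K, (x.map χ).IsDiag → x ∈ R.edgeSet := by
    intro x hx hd
    obtain ⟨φ, hφ, hxφ⟩ := Finset.mem_biUnion.1 hx
    obtain ⟨-, -, hχ⟩ := mem_colouredEmbeddings.1 (hJmem φ hφ).1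
    refine (hJmem φ hφ).2 ?_
    obtain ⟨e, he, rfl⟩ := Finset.mem_image.1 hxφ
    rw [Sym2.map_map, hχ] at hd
    exact Finset.mem_image_of_mem _ (Finset.mem_filter.2 ⟨he, hd⟩)
  unfold SimpleGraph.MakerWinsHGame
  rw [← hboard]
  refine makerWins_of_overlapCost (J := J) (A := copyEdges H) (K := K)
    (v := edgeWeight χ g l M) (t := M / 4) (s := H.edgeFinset.card) ?_ ?_ ?_
    (edgeWeight_pos χ g l hM) (by positivity) ?_ ?_
  · intro x hx
    obtain ⟨φ, hφ, hxφ⟩ := Finset.mem_biUnion.1 hx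
    exact SimpleGraph.mem_edgeFinset.2 (hsub φ hφ hxφ)
  · exact fun φ hφ => Finset.subset_biUnion_of_mem (fun φ => copyEdges H φ) hφ
  · exact fun φ hφ => coe_copyEdges_mem_copyEdgeSets (hJmem φ hφ).1 (hJmem φ hφ).2
  · exact fun φ _ => card_copyEdges_le H φ
  · rw [← hcopy, ← hcost]
    refine lt_of_le_of_lt ?_ h
    exact mul_le_mul_of_nonneg_left (sum_edgeWeight_le hM K hKR) (by positivity)

end Winning

/-! ### First and second moments -/

section Moments

open MeasureTheory

variable {V W : Type*} [Fintype V] [Fintype W] {r : ℕ}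

open Classical in
/-- The cost of an overlap is at most `n ^ (L - g / 2) / M`, up to a constant, where `L` is the
exponent of the overlap. -/
lemma overlapCost_le [Nonempty V] {G : SimpleGraph V} {H : SimpleGraph W} {c : W → Fin r}
    {χ : V → Fin r} {m g l M : ℝ} (h : DensityGap H c m g l) (hM : 0 < M) {φ ψ : W → V}
    (hφ : φ ∈ colouredEmbeddings G c χ) :
    overlapCost (edgeWeight χ g l M) (M / 4) (copyEdges H φ) (copyEdges H ψ)
      ≤ 4 * (H.edgeFinset.card + H.edgeFinset.card ^ 2) *
        ((Fintype.card V : ℝ) ^ (extensionExponent H c l (overlap φ ψ) - g / 2) / M) := by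
  have hN1 : (1 : ℝ) ≤ Fintype.card V := by exact_mod_cast Fintype.card_pos
  have hN : (0 : ℝ) < Fintype.card V := by linarith
  set q := (Fintype.card V : ℝ) ^ (extensionExponent H c l (overlap φ ψ) - g / 2) / M with hq
  have hq0 : 0 < q := by positivity
  have hg := h.gap_pos
  set I := copyEdges H φ ∩ copyEdges H ψ with hI
  have hIcard : I.card ≤ H.edgeFinset.card :=
    (Finset.card_le_card Finset.inter_subset_left).trans (card_copyEdges_le H φ)
  have h1 : ∑ _x ∈ I, 1 / (M / 4) ≤ I.card * (4 * q) := by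
    rw [← nsmul_eq_mul]
    refine Finset.sum_le_card_nsmul _ _ _ fun x hx => ?_
    obtain ⟨hx1, hx2⟩ := Finset.mem_inter.1 hx
    obtain ⟨a, b, -, ha, -, -⟩ := exists_adj_of_mem_copyEdges hx1 hx2
    have hL := h.gap_le_extensionExponent ha
    have hone : 1 ≤ (Fintype.card V : ℝ) ^ (extensionExponent H c l (overlap φ ψ) - g / 2) :=
      Real.one_le_rpow hN1 (by linarith)
    rw [hq, one_div_div, mul_div_assoc']
    exact div_le_div_of_nonneg_right (by linarith) hM.le
  have h2 : ∑ z ∈ I.offDiag, 1 / (edgeWeight χ g l M z.1 + edgeWeight χ g l M z.2)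
      ≤ I.offDiag.card * q := by
    rw [← nsmul_eq_mul]
    refine Finset.sum_le_card_nsmul _ _ _ fun z hz => ?_
    obtain ⟨hz1, hz2, hne⟩ := Finset.mem_offDiag.1 hz
    obtain ⟨hx, hx'⟩ := Finset.mem_inter.1 hz1
    obtain ⟨hy, hy'⟩ := Finset.mem_inter.1 hz2
    have hsingle : ∀ x : Sym2 V,
        edgeExponent χ l x + g ≤ extensionExponent H c l (overlap φ ψ) →
        1 / edgeWeight χ g l M x ≤ q := by
      intro x hx
      have hinv : 1 / edgeWeight χ g l M x
          = (Fintype.card V : ℝ) ^ (g / 2 + edgeExponent χ l x) / M := by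
        unfold edgeWeight
        rw [show -(g / 2) - edgeExponent χ l x = -(g / 2 + edgeExponent χ l x) by ring,
          Real.rpow_neg hN.le]
        field_simp
      rw [hinv, hq]
      exact div_le_div_of_nonneg_right (Real.rpow_le_rpow_of_exponent_le hN1 (by linarith)) hM.le
    have hw1 := edgeWeight_pos χ g l hM z.1
    have hw2 := edgeWeight_pos χ g l hM z.2
    rcases edgeExponent_add_gap_le h hφ hx hx' hy hy' hne with hz | hz
    · exact (one_div_le_one_div_of_le hw1 (by linarith)).trans (hsingle _ hz)
    · exact (one_div_le_one_div_of_le hw2 (by linarith)).trans (hsingle _ hz)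
  have hIc : (I.card : ℝ) ≤ H.edgeFinset.card := by exact_mod_cast hIcard
  have hoff : (I.offDiag.card : ℝ) ≤ (H.edgeFinset.card : ℝ) ^ 2 := by
    have : I.offDiag.card ≤ H.edgeFinset.card ^ 2 := by
      rw [Finset.offDiag_card, sq]
      exact (Nat.sub_le _ _).trans (Nat.mul_le_mul hIcard hIcard)
    exact_mod_cast this
  have h1' := mul_le_mul_of_nonneg_right hIc (by positivity : 0 ≤ 4 * q)
  have h2' := mul_le_mul_of_nonneg_right hoff hq0.le
  have h3 : 0 ≤ (H.edgeFinset.card : ℝ) ^ 2 * q := by positivity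
  have hgoal : overlapCost (edgeWeight χ g l M) (M / 4) (copyEdges H φ) (copyEdges H ψ)
      = ∑ _x ∈ I, 1 / (M / 4)
        + ∑ z ∈ I.offDiag, 1 / (edgeWeight χ g l M z.1 + edgeWeight χ g l M z.2) := by
    rw [overlapCost]
  rw [hgoal]
  linarith

open Classical in
lemma two_mul_card_innerEdges_le {V : Type*} {H : SimpleGraph W} {c : W → Fin r} {φ ψ : W → V}
    (hφ : Function.Injective φ) (hψ : Function.Injective ψ) :
    2 * (innerEdges H c).card ≤ (innerCopyEdges H c φ ∪ innerCopyEdges H c ψ).card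
      + (innerEdgesIn H c (overlap φ ψ)).card := by
  have h1 := Finset.card_union_add_card_inter (innerCopyEdges H c φ) (innerCopyEdges H c ψ)
  have h2 := card_inter_innerCopyEdges_le (H := H) (c := c) (ψ := ψ) hφ
  rw [card_innerCopyEdges hφ, card_innerCopyEdges hψ] at h1
  omega

open Classical in
/-- The expected cost of a pair of copies whose overlap is `U`: the factor `n ^ L = n ^ |U| p ^ e`
in the cost cancels the gain `p ^ (-e)` from at most `e` common inner edges, so that `n ^ |U|`
remains. -/
lemma overlapCost_mul_pow_le [Nonempty V] {G : SimpleGraph V} {H : SimpleGraph W}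
    {c : W → Fin r} {χ : V → Fin r} {m g l M : ℝ} (h : DensityGap H c m g l) (hM : 0 < M)
    {p : ℝ} (hp : p = (Fintype.card V : ℝ) ^ (-l)) {φ ψ : W → V}
    (hφ : φ ∈ colouredEmbeddings G c χ) (hψ : ψ ∈ colouredEmbeddings G c χ) :
    overlapCost (edgeWeight χ g l M) (M / 4) (copyEdges H φ) (copyEdges H ψ) *
        p ^ (innerCopyEdges H c φ ∪ innerCopyEdges H c ψ).card
      ≤ 4 * (H.edgeFinset.card + H.edgeFinset.card ^ 2) * (Fintype.card V : ℝ) ^ (-(g / 2)) / M *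
        p ^ (2 * (innerEdges H c).card) * (Fintype.card V : ℝ) ^ (overlap φ ψ).card := by
  have hN1 : (1 : ℝ) ≤ Fintype.card V := by exact_mod_cast Fintype.card_pos
  have hN : (0 : ℝ) < Fintype.card V := by linarith
  have hp0 : 0 < p := by rw [hp]; positivity
  have hp1 : p ≤ 1 := by
    rw [hp]; exact Real.rpow_le_one_of_one_le_of_nonpos hN1 (by linarith [h.nonneg])
  obtain ⟨-, hφi, -⟩ := mem_colouredEmbeddings.1 hφ
  obtain ⟨-, hψi, -⟩ := mem_colouredEmbeddings.1 hψ
  have hL : (Fintype.card V : ℝ) ^ (extensionExponent H c l (overlap φ ψ) - g / 2)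
      = (Fintype.card V : ℝ) ^ (-(g / 2)) * (Fintype.card V : ℝ) ^ (overlap φ ψ).card *
        p ^ (innerEdgesIn H c (overlap φ ψ)).card := by
    rw [hp, ← Real.rpow_natCast, ← Real.rpow_natCast, ← Real.rpow_mul hN.le, ← Real.rpow_add hN,
      ← Real.rpow_add hN]
    congr 1
    unfold extensionExponent
    ring
  have hpow : p ^ (innerEdgesIn H c (overlap φ ψ)).card *
      p ^ (innerCopyEdges H c φ ∪ innerCopyEdges H c ψ).card
      ≤ p ^ (2 * (innerEdges H c).card) := by
    rw [← pow_add]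
    refine pow_le_pow_of_le_one hp0.le hp1 ?_
    rw [add_comm]
    exact two_mul_card_innerEdges_le hφi hψi
  refine (mul_le_mul_of_nonneg_right (overlapCost_le h hM hφ) (by positivity)).trans ?_
  rw [hL]
  calc 4 * ((H.edgeFinset.card : ℝ) + H.edgeFinset.card ^ 2) *
        ((Fintype.card V : ℝ) ^ (-(g / 2)) * (Fintype.card V : ℝ) ^ (overlap φ ψ).card *
          p ^ (innerEdgesIn H c (overlap φ ψ)).card / M) *
        p ^ (innerCopyEdges H c φ ∪ innerCopyEdges H c ψ).card
      = 4 * ((H.edgeFinset.card : ℝ) + H.edgeFinset.card ^ 2) *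
        (Fintype.card V : ℝ) ^ (-(g / 2)) / M * (Fintype.card V : ℝ) ^ (overlap φ ψ).card *
        (p ^ (innerEdgesIn H c (overlap φ ψ)).card *
          p ^ (innerCopyEdges H c φ ∪ innerCopyEdges H c ψ).card) := by ring
    _ ≤ 4 * ((H.edgeFinset.card : ℝ) + H.edgeFinset.card ^ 2) *
        (Fintype.card V : ℝ) ^ (-(g / 2)) / M * (Fintype.card V : ℝ) ^ (overlap φ ψ).card *
        p ^ (2 * (innerEdges H c).card) := by gcongr
    _ = _ := by ring

lemma not_isDiag_of_mem_union {V : Type*} [DecidableEq V] {H : SimpleGraph W} {c : W → Fin r}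
    {φ ψ : W → V}
    (hφ : Function.Injective φ) (hψ : Function.Injective ψ) :
    ∀ e ∈ innerCopyEdges H c φ ∪ innerCopyEdges H c ψ, ¬ e.IsDiag := fun _ he =>
  (Finset.mem_union.1 he).elim (not_isDiag_of_mem_innerCopyEdges hφ)
    (not_isDiag_of_mem_innerCopyEdges hψ)

open Classical in
lemma integral_totalOverlapCost (p : unitInterval) (G : SimpleGraph V) (H : SimpleGraph W)
    (c : W → Fin r) (χ : V → Fin r) (g l M : ℝ) :
    ∫ R, totalOverlapCost G H c χ g l M R ∂(SimpleGraph.binomialRandom V p)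
      = ∑ φ ∈ colouredEmbeddings G c χ, ∑ ψ ∈ colouredEmbeddings G c χ,
        overlapCost (edgeWeight χ g l M) (M / 4) (copyEdges H φ) (copyEdges H ψ) *
          (p : ℝ) ^ (innerCopyEdges H c φ ∪ innerCopyEdges H c ψ).card := by
  unfold totalOverlapCost
  rw [integral_finsetSum _ fun _ _ => Integrable.of_finite]
  refine Finset.sum_congr rfl fun φ hφ => ?_
  rw [integral_finsetSum _ fun _ _ => Integrable.of_finite]
  refine Finset.sum_congr rfl fun ψ hψ => ?_
  rw [integral_const_mul, integral_containsIndicator p _ (not_isDiag_of_mem_union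
    (mem_colouredEmbeddings.1 hφ).2.1 (mem_colouredEmbeddings.1 hψ).2.1)]

open Classical in
/-- The expected total overlap cost is smaller than the expected number `M` of copies by a factor
of order `n ^ (-g / 2)`. -/
lemma integral_totalOverlapCost_le [Nonempty V] {G : SimpleGraph V} {H : SimpleGraph W}
    {c : W → Fin r} {χ : V → Fin r} {m g l : ℝ} (h : DensityGap H c m g l)
    {p : unitInterval} (hp : (p : ℝ) = (Fintype.card V : ℝ) ^ (-l)) {d : ℝ} (hd : 0 < d)
    (hΦ : d * (Fintype.card V : ℝ) ^ Fintype.card W ≤ ((colouredEmbeddings G c χ).card : ℝ))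
    {M : ℝ} (hM : M = (colouredEmbeddings G c χ).card * (p : ℝ) ^ (innerEdges H c).card) :
    ∫ R, totalOverlapCost G H c χ g l M R ∂(SimpleGraph.binomialRandom V p)
      ≤ 4 * (H.edgeFinset.card + H.edgeFinset.card ^ 2) *
        ((Fintype.card W + 1) ^ Fintype.card W / d ^ 2) *
        (Fintype.card V : ℝ) ^ (-(g / 2)) * M := by
  have hN : (0 : ℝ) < Fintype.card V := by exact_mod_cast Fintype.card_pos
  have hp0 : 0 < (p : ℝ) := by rw [hp]; positivity
  have hMge : d * (Fintype.card V : ℝ) ^ Fintype.card W * (p : ℝ) ^ (innerEdges H c).card ≤ M := by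
    rw [hM]; gcongr
  have hMpos : 0 < M := lt_of_lt_of_le (by positivity) hMge
  set Φ := colouredEmbeddings G c χ
  set N : ℝ := (Fintype.card V : ℝ)
  set v := Fintype.card W
  set e := (innerEdges H c).card
  set C : ℝ := 4 * ((H.edgeFinset.card : ℝ) + H.edgeFinset.card ^ 2) with hC
  have hC0 : 0 ≤ C := by positivity
  have hsum : ∑ φ ∈ Φ, ∑ ψ ∈ Φ, N ^ (overlap φ ψ).card ≤ N ^ v * ((v + 1) * N) ^ v := by
    rw [Finset.sum_comm]
    calc ∑ ψ ∈ Φ, ∑ φ ∈ Φ, N ^ (overlap φ ψ).card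
        ≤ ∑ _ψ ∈ Φ, ((v + 1) * N) ^ v := by
          refine Finset.sum_le_sum fun ψ _ => ?_
          refine le_trans ?_ (sum_pow_card_overlap_le ψ)
          exact Finset.sum_le_univ_sum_of_nonneg fun φ => by positivity
      _ ≤ ∑ _ψ : W → V, ((v + 1) * N) ^ v :=
          Finset.sum_le_univ_sum_of_nonneg fun φ => by positivity
      _ = _ := by simp [N, v]
  rw [integral_totalOverlapCost]
  calc ∑ φ ∈ Φ, ∑ ψ ∈ Φ,
        overlapCost (edgeWeight χ g l M) (M / 4) (copyEdges H φ) (copyEdges H ψ) *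
          (p : ℝ) ^ (innerCopyEdges H c φ ∪ innerCopyEdges H c ψ).card
      ≤ ∑ φ ∈ Φ, ∑ ψ ∈ Φ, C * N ^ (-(g / 2)) / M * (p : ℝ) ^ (2 * e) *
          N ^ (overlap φ ψ).card :=
        Finset.sum_le_sum fun φ hφ => Finset.sum_le_sum fun ψ hψ =>
          overlapCost_mul_pow_le h hMpos hp hφ hψ
    _ = C * N ^ (-(g / 2)) / M * (p : ℝ) ^ (2 * e) *
          ∑ φ ∈ Φ, ∑ ψ ∈ Φ, N ^ (overlap φ ψ).card := by
        simp_rw [Finset.mul_sum]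
    _ ≤ C * N ^ (-(g / 2)) / M * (p : ℝ) ^ (2 * e) * (N ^ v * ((v + 1) * N) ^ v) := by gcongr
    _ = C * N ^ (-(g / 2)) / M * ((v + 1) ^ v / d ^ 2) * (d * N ^ v * (p : ℝ) ^ e) ^ 2 := by
        rw [mul_pow]
        field_simp
        ring
    _ ≤ C * N ^ (-(g / 2)) / M * ((v + 1) ^ v / d ^ 2) * M ^ 2 := by gcongr
    _ = _ := by
        field_simp

open Classical in
/-- The variance of the number of copies is bounded by their expected total overlap cost, since
copies that share no inner edge are independent. -/
lemma integral_copyNumber_sub_sq_le (p : unitInterval) {G : SimpleGraph V} {H : SimpleGraph W}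
    {c : W → Fin r} {χ : V → Fin r} {g l : ℝ} [Nonempty V] {M : ℝ} (hMpos : 0 < M)
    (hM : M = (colouredEmbeddings G c χ).card * (p : ℝ) ^ (innerEdges H c).card) :
    ∫ R, (copyNumber G H c χ R - M) ^ 2 ∂(SimpleGraph.binomialRandom V p)
      ≤ M / 4 * ∫ R, totalOverlapCost G H c χ g l M R ∂(SimpleGraph.binomialRandom V p) := by
  set Φ := colouredEmbeddings G c χ with hΦ
  set e := (innerEdges H c).card with he
  have hinj : ∀ φ ∈ Φ, Function.Injective φ := fun φ hφ => (mem_colouredEmbeddings.1 hφ).2.1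
  have hp0 : 0 ≤ (p : ℝ) := p.2.1
  have hEX : ∫ R, copyNumber G H c χ R ∂(SimpleGraph.binomialRandom V p) = M := by
    unfold copyNumber
    rw [integral_finsetSum _ fun _ _ => Integrable.of_finite, hM, ← nsmul_eq_mul,
      ← Finset.sum_const]
    refine Finset.sum_congr rfl fun φ hφ => ?_
    rw [integral_containsIndicator p _ fun e he =>
      not_isDiag_of_mem_innerCopyEdges (hinj φ hφ) he, card_innerCopyEdges (hinj φ hφ)]
  have hEX2 : ∫ R, copyNumber G H c χ R ^ 2 ∂(SimpleGraph.binomialRandom V p)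
      = ∑ φ ∈ Φ, ∑ ψ ∈ Φ, (p : ℝ) ^ (innerCopyEdges H c φ ∪ innerCopyEdges H c ψ).card := by
    have hsq : ∀ R, copyNumber G H c χ R ^ 2 = ∑ φ ∈ Φ, ∑ ψ ∈ Φ,
        containsIndicator (innerCopyEdges H c φ ∪ innerCopyEdges H c ψ) R := by
      intro R
      unfold copyNumber
      rw [sq, Finset.sum_mul_sum]
      simp_rw [containsIndicator_mul]
      rfl
    simp_rw [hsq]
    rw [integral_finsetSum _ fun _ _ => Integrable.of_finite]
    refine Finset.sum_congr rfl fun φ hφ => ?_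
    rw [integral_finsetSum _ fun _ _ => Integrable.of_finite]
    refine Finset.sum_congr rfl fun ψ hψ => ?_
    rw [integral_containsIndicator p _ (not_isDiag_of_mem_union (hinj φ hφ) (hinj ψ hψ))]
  have hcost0 : ∀ φ ψ, 0 ≤
      overlapCost (edgeWeight χ g l M) (M / 4) (copyEdges H φ) (copyEdges H ψ) := by
    exact fun φ ψ => overlapCost_nonneg (edgeWeight_pos χ g l hMpos) (by positivity) _ _
  have hpair : ∀ φ ∈ Φ, ∀ ψ ∈ Φ,
      (p : ℝ) ^ (innerCopyEdges H c φ ∪ innerCopyEdges H c ψ).card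
        ≤ (p : ℝ) ^ e * (p : ℝ) ^ e + M / 4 *
          (overlapCost (edgeWeight χ g l M) (M / 4) (copyEdges H φ) (copyEdges H ψ) *
            (p : ℝ) ^ (innerCopyEdges H c φ ∪ innerCopyEdges H c ψ).card) := by
    intro φ hφ ψ hψ
    by_cases hdis : Disjoint (innerCopyEdges H c φ) (innerCopyEdges H c ψ)
    · rw [Finset.card_union_of_disjoint hdis, card_innerCopyEdges (hinj φ hφ),
        card_innerCopyEdges (hinj ψ hψ), ← he, ← pow_add]
      have := hcost0 φ ψ
      exact le_add_of_nonneg_right (by positivity)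
    · obtain ⟨x, hx1, hx2⟩ := Finset.not_disjoint_iff.1 hdis
      have hone : 1 ≤ M / 4 *
          overlapCost (edgeWeight χ g l M) (M / 4) (copyEdges H φ) (copyEdges H ψ) := by
        have hge := one_div_le_overlapCost (edgeWeight_pos χ g l hMpos)
          (by positivity : 0 < M / 4) (innerCopyEdges_subset H c φ hx1)
          (innerCopyEdges_subset H c ψ hx2)
        calc (1 : ℝ) = M / 4 * (1 / (M / 4)) := by field_simp
          _ ≤ _ := by gcongr
      have hpow : 0 ≤ (p : ℝ) ^ (innerCopyEdges H c φ ∪ innerCopyEdges H c ψ).card := by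
        positivity
      have := mul_le_mul_of_nonneg_right hone hpow
      have hpe : 0 ≤ (p : ℝ) ^ e * (p : ℝ) ^ e := by positivity
      linarith
  have hexp : ∫ R, (copyNumber G H c χ R - M) ^ 2 ∂(SimpleGraph.binomialRandom V p)
      = ∫ R, copyNumber G H c χ R ^ 2 ∂(SimpleGraph.binomialRandom V p) - M ^ 2 := by
    have hsq : ∀ R, (copyNumber G H c χ R - M) ^ 2
        = copyNumber G H c χ R ^ 2 - (2 * M * copyNumber G H c χ R - M ^ 2) := fun R => by ring
    simp_rw [hsq]
    rw [integral_sub Integrable.of_finite Integrable.of_finite,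
      integral_sub Integrable.of_finite Integrable.of_finite, integral_const_mul, hEX]
    simp
    ring
  rw [hexp, hEX2, integral_totalOverlapCost]
  have hfinal := Finset.sum_le_sum fun φ hφ => Finset.sum_le_sum fun ψ hψ => hpair φ hφ ψ hψ
  have hM2 : ∑ _φ ∈ Φ, ∑ _ψ ∈ Φ, (p : ℝ) ^ e * (p : ℝ) ^ e = M ^ 2 := by
    rw [hM]
    simp only [Finset.sum_const, nsmul_eq_mul]
    ring
  simp_rw [Finset.sum_add_distrib] at hfinal
  rw [hM2] at hfinal
  simp_rw [← Finset.mul_sum] at hfinal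
  linarith

open Classical in
lemma integral_totalWeight_le [Nonempty V] {l g M : ℝ} (hM : 0 ≤ M) {p : unitInterval}
    (hp : (p : ℝ) = (Fintype.card V : ℝ) ^ (-l)) :
    ∫ R, totalWeight g l M R ∂(SimpleGraph.binomialRandom V p)
      ≤ 2 * (Fintype.card V : ℝ) ^ (-(g / 2)) * M := by
  have hN : (0 : ℝ) < Fintype.card V := by exact_mod_cast Fintype.card_pos
  unfold totalWeight
  rw [integral_add Integrable.of_finite Integrable.of_finite,
    integral_finsetSum _ fun _ _ => Integrable.of_finite]
  have hterm : ∀ x ∈ Finset.univ.filter (fun x : Sym2 V => ¬ x.IsDiag),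
      ∫ R, M * (Fintype.card V : ℝ) ^ (-(g / 2) - (2 - l)) * containsIndicator {x} R
        ∂(SimpleGraph.binomialRandom V p) = M * (Fintype.card V : ℝ) ^ (-(g / 2) - 2) := by
    intro x hx
    rw [integral_const_mul, integral_containsIndicator p _ (by simpa using hx), hp]
    rw [Finset.card_singleton, pow_one, mul_assoc, ← Real.rpow_add hN]
    congr 2
    ring
  rw [Finset.sum_congr rfl hterm, Finset.sum_const, nsmul_eq_mul]
  have h1 : ((Finset.univ.filter (fun x : Sym2 V => ¬ x.IsDiag)).card : ℝ)
      ≤ (Fintype.card V : ℝ) ^ 2 := by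
    refine le_trans ?_ (card_sym2_le_sq (V := V))
    exact_mod_cast Finset.card_le_univ _
  have h2 : (Fintype.card V : ℝ) ^ 2 * (Fintype.card V : ℝ) ^ (-(g / 2) - 2)
      = (Fintype.card V : ℝ) ^ (-(g / 2)) := by
    rw [← Real.rpow_natCast, ← Real.rpow_add hN]
    congr 1
    push_cast
    ring
  have h3 : ((Finset.univ.filter (fun x : Sym2 V => ¬ x.IsDiag)).card : ℝ) *
      (M * (Fintype.card V : ℝ) ^ (-(g / 2) - 2)) ≤ (Fintype.card V : ℝ) ^ (-(g / 2)) * M := by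
    calc _ ≤ (Fintype.card V : ℝ) ^ 2 * (M * (Fintype.card V : ℝ) ^ (-(g / 2) - 2)) := by gcongr
      _ = ((Fintype.card V : ℝ) ^ 2 * (Fintype.card V : ℝ) ^ (-(g / 2) - 2)) * M := by ring
      _ = _ := by rw [h2]
  simp only [integral_const, probReal_univ, one_smul]
  linarith

end Moments

/-! ### The probability that Maker wins -/

section WinningProbability

open MeasureTheory

open Classical in
/-- Breaker wins with probability `O(n ^ (-g / 2))`. -/
lemma prob_not_makerWinsHGame_le {V W : Type*} [Fintype V] [Fintype W] {r : ℕ} [Nonempty V]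
    {G : SimpleGraph V} {H : SimpleGraph W}
    {c : W → Fin r} {χ : V → Fin r} {m g l : ℝ} (h : DensityGap H c m g l)
    {p : unitInterval} (hp : (p : ℝ) = (Fintype.card V : ℝ) ^ (-l)) {d : ℝ} (hd : 0 < d)
    (hΦ : d * (Fintype.card V : ℝ) ^ Fintype.card W ≤ ((colouredEmbeddings G c χ).card : ℝ)) :
    (SimpleGraph.binomialRandom V p).real {R | ¬ H.MakerWinsHGame (G ⊔ R)}
      ≤ (12 * (4 * (H.edgeFinset.card + H.edgeFinset.card ^ 2) *
          ((Fintype.card W + 1) ^ Fintype.card W / d ^ 2)) + 16 * 2 ^ H.edgeFinset.card) *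
        (Fintype.card V : ℝ) ^ (-(g / 2)) := by
  have hN : (0 : ℝ) < Fintype.card V := by exact_mod_cast Fintype.card_pos
  have hp0 : 0 < (p : ℝ) := by rw [hp]; positivity
  obtain ⟨M, hM⟩ : ∃ M : ℝ,
      M = (colouredEmbeddings G c χ).card * (p : ℝ) ^ (innerEdges H c).card := ⟨_, rfl⟩
  have hMpos : 0 < M := by
    have : 0 < ((colouredEmbeddings G c χ).card : ℝ) := lt_of_lt_of_le (by positivity) hΦ
    rw [hM]; positivity
  set P := SimpleGraph.binomialRandom V p with hP
  have hY := integral_totalOverlapCost_le h hp hd hΦ hM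
  have hX := integral_copyNumber_sub_sq_le (g := g) (l := l) p hMpos hM
  have hZ := integral_totalWeight_le (l := l) (g := g) hMpos.le hp
  rw [← hP] at hX hY hZ
  set s := H.edgeFinset.card
  set C : ℝ := 4 * ((s : ℝ) + s ^ 2) * ((Fintype.card W + 1) ^ Fintype.card W / d ^ 2)
  set ν : ℝ := (Fintype.card V : ℝ) ^ (-(g / 2))
  set X := copyNumber G H c χ with hXdef
  set Y := totalOverlapCost G H c χ g l M with hYdef
  set Z := totalWeight (V := V) g l M with hZdef
  have hY0 : ∀ R, 0 ≤ Y R := fun R => by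
    exact Finset.sum_nonneg fun φ _ => Finset.sum_nonneg fun ψ _ => mul_nonneg
      (overlapCost_nonneg (edgeWeight_pos χ g l hMpos) (by positivity) _ _)
      (containsIndicator_nonneg _ _)
  have hZ0 : ∀ R, 0 ≤ Z R := fun R =>
    add_nonneg (by positivity) (Finset.sum_nonneg fun x _ =>
      mul_nonneg (by positivity) (containsIndicator_nonneg _ _))
  -- If the sum of the three error terms is less than `1`, then each of them is, and Maker wins.
  let Q : SimpleGraph V → ℝ := fun R =>
    16 / M ^ 2 * (X R - M) ^ 2 + (8 / M * Y R + 8 * 2 ^ s / M * Z R)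
  have hQ0 : ∀ R, 0 ≤ Q R := fun R => by
    have := hY0 R
    have := hZ0 R
    positivity
  have hsub : {R | ¬ H.MakerWinsHGame (G ⊔ R)} ⊆ {R | 1 ≤ Q R} := by
    intro R hR
    by_contra hQ
    have hQ' : Q R < 1 := not_le.1 hQ
    refine hR (makerWinsHGame_of_counts (c := c) (χ := χ) (g := g) (l := l) hMpos ?_)
    have t1 : 0 ≤ 16 / M ^ 2 * (X R - M) ^ 2 := by positivity
    have t2 : 0 ≤ 8 / M * Y R := mul_nonneg (by positivity) (hY0 R)
    have t3 : 0 ≤ 8 * 2 ^ s / M * Z R := mul_nonneg (by positivity) (hZ0 R)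
    have hQ'' : 16 / M ^ 2 * (X R - M) ^ 2 + (8 / M * Y R + 8 * 2 ^ s / M * Z R) < 1 := hQ'
    have u1 : 16 / M ^ 2 * (X R - M) ^ 2 < 1 := by linarith
    have u2 : 8 / M * Y R < 1 := by linarith
    have u3 : 8 * 2 ^ s / M * Z R < 1 := by linarith
    rw [div_mul_eq_mul_div, div_lt_one (by positivity)] at u1 u2 u3
    have hXge : 3 / 4 * M ≤ X R := by
      by_contra hlt
      push Not at hlt
      nlinarith
    linarith
  have hEQ : ∫ R, Q R ∂P ≤ (12 * C + 16 * 2 ^ s) * ν := by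
    have hint : ∫ R, Q R ∂P = 16 / M ^ 2 * ∫ R, (X R - M) ^ 2 ∂P
        + (8 / M * ∫ R, Y R ∂P + 8 * 2 ^ s / M * ∫ R, Z R ∂P) := by
      simp only [Q]
      rw [integral_add Integrable.of_finite Integrable.of_finite,
        integral_add Integrable.of_finite Integrable.of_finite, integral_const_mul,
        integral_const_mul, integral_const_mul]
    have hX' : 16 / M ^ 2 * ∫ R, (X R - M) ^ 2 ∂P ≤ 4 / M * ∫ R, Y R ∂P := by
      calc 16 / M ^ 2 * ∫ R, (X R - M) ^ 2 ∂P ≤ 16 / M ^ 2 * (M / 4 * ∫ R, Y R ∂P) := by gcongr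
        _ = _ := by field_simp; norm_num
    have hY' : 12 / M * ∫ R, Y R ∂P ≤ 12 * C * ν := by
      calc 12 / M * ∫ R, Y R ∂P ≤ 12 / M * (C * ν * M) := by gcongr
        _ = _ := by field_simp
    have hZ' : 8 * 2 ^ s / M * ∫ R, Z R ∂P ≤ 16 * 2 ^ s * ν := by
      calc 8 * 2 ^ s / M * ∫ R, Z R ∂P ≤ 8 * 2 ^ s / M * (2 * ν * M) := by gcongr
        _ = _ := by field_simp; ring
    have hsplit : 12 / M * ∫ R, Y R ∂P = 4 / M * ∫ R, Y R ∂P + 8 / M * ∫ R, Y R ∂P := by ring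
    rw [hint]
    linarith
  have hMarkov := mul_meas_ge_le_integral_of_nonneg (μ := P) (f := Q)
    (Filter.Eventually.of_forall hQ0) Integrable.of_finite 1
  rw [one_mul] at hMarkov
  exact (measureReal_mono hsub).trans (hMarkov.trans hEQ)

/-- The exponent `l` of an edge probability `p = n ^ (-l)` that exceeds the threshold
`n ^ (-1 / m)` by a polynomial factor. -/
lemma exists_exponent {n : ℝ} (hn : 1 < n) {m γ : ℝ} {p : ℝ} (hp1 : p ≤ 1)
    (hp : n ^ (-1 / m + γ) ≤ p) :
    ∃ l : ℝ, p = n ^ (-l) ∧ 0 ≤ l ∧ l ≤ 1 / m - min γ 1 := by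
  have hn0 : 0 < n := by linarith
  have hp0 : 0 < p := lt_of_lt_of_le (by positivity) hp
  refine ⟨-Real.logb n p, ?_, ?_, ?_⟩
  · rw [neg_neg, Real.rpow_logb hn0 hn.ne' hp0]
  · have := Real.logb_nonpos hn hp0.le hp1
    linarith
  · have := (Real.le_logb_iff_rpow_le hn hp0).2 hp
    have hmin := min_le_left γ 1
    have heq : -1 / m = -(1 / m) := by ring
    linarith

theorem theorem1p5 {W : Type*} [Finite W] (H : SimpleGraph W)
    (γ : ℝ) (hγ : 0 < γ) (r : ℕ) (hr : 2 ≤ r)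
    (α : ℝ) (hα₁ : ((r : ℝ) - 2) / ((r : ℝ) - 1) < α) (hα₂ : α ≤ ((r : ℝ) - 1) / (r : ℝ))
    (hH : 0 < H.partiteTwoDensity r)
    (G : ∀ n : ℕ, SimpleGraph (Fin n)) [∀ n, DecidableRel (G n).Adj]
    (hG : ∀ᶠ n : ℕ in atTop, α * (n : ℝ) ≤ ((G n).minDegree : ℝ))
    (p : ℕ → unitInterval)
    (hp : ∀ᶠ n : ℕ in atTop, (n : ℝ) ^ (-1 / H.partiteTwoDensity r + γ) ≤ (p n : ℝ)) :
    Tendsto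
      (fun n : ℕ => SimpleGraph.binomialRandom (Fin n) (p n)
        {R : SimpleGraph (Fin n) | H.MakerWinsHGame (G n ⊔ R)})
      atTop (𝓝 1) := by
  classical
  have := Fintype.ofFinite W
  have hr' : (2 : ℝ) ≤ r := by exact_mod_cast hr
  obtain ⟨hm, c, hc⟩ := exists_colouring_partiteTwoDensity H (by omega : 0 < r) hH
  set m := H.partiteTwoDensity r
  have hg : 0 < min γ 1 := lt_min hγ one_pos
  -- In `G n` every `r - 1` vertices have at least `δ n` common neighbours.
  obtain ⟨δ, hδ⟩ : ∃ δ : ℝ, δ = 1 - (r - 1) * (1 - α) := ⟨_, rfl⟩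
  have hδ0 : 0 < δ := by
    rw [div_lt_iff₀ (by linarith)] at hα₁
    rw [hδ]; linarith
  have hα1 : α ≤ 1 := hα₂.trans (by rw [div_le_one (by linarith)]; linarith)
  have hδk : ∀ j < r, δ ≤ 1 - j * (1 - α) := by
    intro j hj
    have hj' : (j : ℝ) ≤ r - 1 := by
      have : (j : ℝ) + 1 ≤ r := by exact_mod_cast hj
      linarith
    have := mul_le_mul_of_nonneg_right hj' (by linarith : 0 ≤ 1 - α)
    rw [hδ]; linarith
  set v := Fintype.card W with hv
  obtain ⟨D, hD⟩ : ∃ D : ℝ, D = (δ ^ r) ^ 2 ^ v := ⟨_, rfl⟩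
  have hD0 : 0 < D := by rw [hD]; positivity
  obtain ⟨d, hd⟩ : ∃ d : ℝ, d = D / (2 * (r : ℝ) ^ v) := ⟨_, rfl⟩
  have hd0 : 0 < d := by rw [hd]; positivity
  obtain ⟨C, hC⟩ : ∃ C : ℝ, C = 12 * (4 * (H.edgeFinset.card + H.edgeFinset.card ^ 2) *
    ((Fintype.card W + 1) ^ Fintype.card W / d ^ 2)) + 16 * 2 ^ H.edgeFinset.card := ⟨_, rfl⟩
  have hbound : ∀ᶠ n : ℕ in atTop,
      (SimpleGraph.binomialRandom (Fin n) (p n)).real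
        {R : SimpleGraph (Fin n) | ¬ H.MakerWinsHGame (G n ⊔ R)}
      ≤ C * (n : ℝ) ^ (-(min γ 1 / 2)) := by
    have hlarge : ∀ᶠ n : ℕ in atTop, 2 * (v : ℝ) ^ 2 ≤ D * n :=
      (tendsto_natCast_atTop_atTop.const_mul_atTop hD0).eventually_ge_atTop _
    filter_upwards [hG, hp, hlarge, eventually_ge_atTop 2] with n hGn hpn hln hn
    have : Nonempty (Fin n) := ⟨⟨0, by omega⟩⟩
    have hn1 : (1 : ℝ) < n := by exact_mod_cast hn
    obtain ⟨l, hl, hl0, hl1⟩ := exists_exponent hn1 (p n).2.2 hpn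
    have hdeg : ∀ x, α * Fintype.card (Fin n) ≤ ((G n).degree x : ℝ) := by
      intro x
      rw [Fintype.card_fin]
      exact hGn.trans (by exact_mod_cast (G n).minDegree_le_degree x)
    have hcl : δ ^ r * (Fintype.card (Fin n) : ℝ) ^ r
        ≤ ((crossHoms (G n) (id : Fin r → Fin r)).card : ℝ) := by
      rw [← mul_pow]
      exact card_cliques_ge (G n) hδ0.le hdeg r hδk
    obtain ⟨χ, hχ⟩ := exists_card_colouredEmbeddings_ge (G n) (by omega : 0 < r)
      (by positivity) hcl c (by rw [Fintype.card_fin, ← hv, ← hD]; exact hln)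
    rw [← hv, ← hD, ← hd] at hχ
    have hgap : DensityGap H c m (min γ 1) l := ⟨hm, hg, min_le_right _ _, hl0, hl1, hc⟩
    have hfin := prob_not_makerWinsHGame_le hgap (p := p n) (by rw [Fintype.card_fin]; exact hl)
      hd0 hχ
    rw [Fintype.card_fin] at hfin
    rw [hC]
    exact hfin
  have hlim : Tendsto (fun n : ℕ => ENNReal.ofReal (1 - C * (n : ℝ) ^ (-(min γ 1 / 2))))
      atTop (𝓝 1) := by
    have h0 : Tendsto (fun n : ℕ => (n : ℝ) ^ (-(min γ 1 / 2))) atTop (𝓝 0) :=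
      (tendsto_rpow_neg_atTop (by positivity)).comp tendsto_natCast_atTop_atTop
    have h1 := (h0.const_mul C).const_sub 1
    rw [mul_zero, sub_zero] at h1
    simpa using ENNReal.tendsto_ofReal h1
  refine tendsto_of_tendsto_of_tendsto_of_le_of_le' hlim tendsto_const_nhds ?_
    (Filter.Eventually.of_forall fun n => prob_le_one)
  filter_upwards [hbound] with n hn
  have hcompl := probReal_compl_eq_one_sub (μ := SimpleGraph.binomialRandom (Fin n) (p n))
    (s := {R : SimpleGraph (Fin n) | H.MakerWinsHGame (G n ⊔ R)}) (Set.toFinite _).measurableSet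
  rw [Set.compl_ofPred] at hcompl
  rw [hcompl] at hn
  rw [← ENNReal.ofReal_toReal (measure_ne_top (SimpleGraph.binomialRandom (Fin n) (p n))
    {R : SimpleGraph (Fin n) | H.MakerWinsHGame (G n ⊔ R)})]
  refine ENNReal.ofReal_le_ofReal ?_
  rw [measureReal_def] at hn
  linarith

end WinningProbability
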